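/- For a prime power $n$ let $\mathbb{F}_n$ be the field with $n$ elements, identified with $[n]=\{1,\dots,n\}$ by some fixed bijection. For $t\in[n]$ put $$NW_{t,n}=\sum_{\substack{f\in\mathbb{F}_n[z]\\ \deg f<\lfloor n/(2t)\rfloor}}\ \prod_{i\in[n]}x_{i,f(i)},\qquad NW_n=\sum_{t=1}^n y_t\cdot NW_{t,n},$$ polynomials over a field $\mathbb{F}$ in the variables $x_{i,j}$, $y_i$ ($i,j\in[n]$); here $\deg 0=-\infty$. An arithmetic circuit is a finite directed acyclic graph whose nodes are leaves (labelled by field elements or variables) or $+$ or $\times$ gates of unbounded fan-in; its size is the number of its nodes. It is homogeneous if every node computes a homogeneous polynomial. A $\Sigma\Pi\Sigma\Pi$ circuit has a $+$ gate as output, followed by layers of $\times$, $+$, $\times$ gates and then leaves; it computes a polynomial of the form $\sum_{i=1}^r\prod_{j=1}^{d_i}Q_{ij}$ with each $Q_{ij}$ computed by a $\Sigma\Pi$ circuit. A homogeneous $\Sigma\Pi\Sigma\Pi$ circuit is a $\Sigma\Pi\Sigma\Pi^*$ circuit if the multiset $\{\deg Q_{ij}: 1\le j\le d_i\}$ (counted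 with multiplicity) is the same for every $i$, where a $Q_{ij}$ that is identically zero may be counted with any degree. Theorem. There is an absolute constant $\epsilon>0$ such that, over every field $\mathbb{F}$ and for every choice of the identifications $[n]\cong\mathbb{F}_n$, the following holds. The family $\{NW_n\}$, indexed by the prime powers $n$, is in $\mathrm{VNP}$; and for every prime power $n$, the polynomial $NW_n$ is homogeneous of degree $n+1$, exactly $n^2+n$ variables occur in it, and every homogeneous $\Sigma\Pi\Sigma\Pi^*$ circuit computing $NW_n$ has size at least $\exp(n^{\epsilon})$, with no restriction on the top fan-in $r$. -/

import Mathlib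

/-! ### Arithmetic circuits -/

/-- The label of a node of an arithmetic circuit together with its in-edges: a leaf (field element
or variable) has none, a sum or product gate has unbounded fan-in.  Parallel edges are allowed. -/
inductive Gate (F σ ν : Type*) where
  | const (c : F) : Gate F σ ν
  | var (x : σ) : Gate F σ ν
  | add (s : Multiset ν) : Gate F σ ν
  | mul (s : Multiset ν) : Gate F σ ν

/-- The nodes that feed into a gate. -/
def Gate.inputs {F σ ν : Type*} : Gate F σ ν → Multiset ν
  | .const _ => 0
  | .var _ => 0
  | .add s => s
  | .mul s => s

/-- An arithmetic circuit over `F` in the variables `σ`: a finite directed graph without cycles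
(for a finite graph this is well-foundedness of the edge relation) with a chosen output node. -/
structure ArithCircuit (F σ : Type*) where
  Node : Type
  [fintypeNode : Fintype Node]
  gate : Node → Gate F σ Node
  acyclic : WellFounded (fun w v : Node => w ∈ (gate v).inputs)
  output : Node

namespace ArithCircuit

attribute [instance] ArithCircuit.fintypeNode

variable {F σ : Type*}

/-- The nodes that feed into the node `v`. -/
def inputs (C : ArithCircuit F σ) (v : C.Node) : Multiset C.Node := (C.gate v).inputs

/-- The size of a circuit: its number of nodes. -/
def size (C : ArithCircuit F σ) : ℕ := Fintype.card C.Node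

/-- The number of edges of a circuit, counted with multiplicity. -/
def wires (C : ArithCircuit F σ) : ℕ := ∑ v : C.Node, (C.inputs v).card

/-- The value of a gate, given the polynomials computed at its inputs. -/
noncomputable def gateValue [CommSemiring F] {ν : Type*} :
    (g : Gate F σ ν) → ((w : ν) → w ∈ g.inputs → MvPolynomial σ F) → MvPolynomial σ F
  | .const c, _ => MvPolynomial.C c
  | .var x, _ => MvPolynomial.X x
  | .add s, val => (s.attach.map fun w => val w.1 w.2).sum
  | .mul s, val => (s.attach.map fun w => val w.1 w.2).prod

/-- The polynomial computed at a node. -/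
noncomputable def value [CommSemiring F] (C : ArithCircuit F σ) : C.Node → MvPolynomial σ F :=
  C.acyclic.fix fun v val => gateValue (C.gate v) val

theorem value_eq [CommSemiring F] (C : ArithCircuit F σ) (v : C.Node) :
    C.value v = gateValue (C.gate v) (fun w _ => C.value w) :=
  C.acyclic.fix_eq _ v

/-- The polynomial computed by the circuit. -/
noncomputable def poly [CommSemiring F] (C : ArithCircuit F σ) : MvPolynomial σ F :=
  C.value C.output

/-- A circuit is homogeneous if every node computes a homogeneous polynomial. -/
def IsHomogeneous [CommSemiring F] (C : ArithCircuit F σ) : Prop :=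
  ∀ v : C.Node, ∃ d : ℕ, (C.value v).IsHomogeneous d

/-- `v` is a leaf: it is labelled by a field element or by a variable. -/
def IsLeaf (C : ArithCircuit F σ) (v : C.Node) : Prop :=
  (∃ c, C.gate v = .const c) ∨ ∃ x, C.gate v = .var x

/-- `v` is a product gate. -/
def IsMul (C : ArithCircuit F σ) (v : C.Node) : Prop := ∃ s, C.gate v = .mul s

/-- `v` is a sum gate. -/
def IsAdd (C : ArithCircuit F σ) (v : C.Node) : Prop := ∃ s, C.gate v = .add s

/-- Depth four circuits, `ΣΠΣΠ`: the output is a sum gate, and going down from it one meets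
product gates, sum gates, product gates and then leaves. -/
def IsSPSP (C : ArithCircuit F σ) : Prop :=
  C.IsAdd C.output ∧
  ∀ u ∈ C.inputs C.output, C.IsMul u ∧
  ∀ v ∈ C.inputs u, C.IsAdd v ∧
  ∀ w ∈ C.inputs v, C.IsMul w ∧
  ∀ l ∈ C.inputs w, C.IsLeaf l

/-- All gates that feed into the output have the same multiset `D` of degrees of their inputs,
i.e. the inputs of each of them can be matched with `D` so that an input matched with `d`
computes a homogeneous polynomial of degree `d`.  (For a nonzero homogeneous polynomial this `d`
is its degree; the zero polynomial may count with any degree.) -/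
def HasUniformDegrees [CommSemiring F] (C : ArithCircuit F σ) : Prop :=
  ∃ D : Multiset ℕ, ∀ u ∈ C.inputs C.output,
    Multiset.Rel (fun v d => (C.value v).IsHomogeneous d) (C.inputs u) D

/-- Homogeneous `ΣΠΣΠ*` circuits. -/
def IsHomogeneousSPSPStar [CommSemiring F] (C : ArithCircuit F σ) : Prop :=
  C.IsHomogeneous ∧ C.IsSPSP ∧ C.HasUniformDegrees

end ArithCircuit

/-! ### The class VNP -/

/-- The family `f n`, `n ∈ S`, of polynomials in the variables `σ n` is in Valiant's class `VNP`
over `F`: the number of variables and the degree are polynomially bounded in `n`, and `f n` is the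
sum, over all `0/1` assignments to `m ≤ p n` auxiliary variables, of a polynomial of polynomially
bounded degree computed by a circuit of polynomially bounded size. -/
def InVNP (F : Type*) [Field F] {S : Set ℕ} {σ : S → Type} [∀ n, Fintype (σ n)]
    (f : ∀ n : S, MvPolynomial (σ n) F) : Prop :=
  ∃ p : Polynomial ℕ, ∀ n : S,
    Fintype.card (σ n) ≤ p.eval (n : ℕ) ∧
    (f n).totalDegree ≤ p.eval (n : ℕ) ∧
    ∃ (m : ℕ) (C : ArithCircuit F (σ n ⊕ Fin m)),
      m ≤ p.eval (n : ℕ) ∧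
      C.size ≤ p.eval (n : ℕ) ∧
      C.wires ≤ p.eval (n : ℕ) ∧
      C.poly.totalDegree ≤ p.eval (n : ℕ) ∧
      f n = ∑ b : Fin m → Bool,
        MvPolynomial.aeval
          (Sum.elim MvPolynomial.X fun j => if b j then (1 : MvPolynomial (σ n) F) else 0)
          C.poly

/-! ### Nisan–Wigderson polynomials -/

/-- There are finitely many polynomials of degree `< d` over a finite field. -/
noncomputable instance instFintypeDegreeLT (K : Type*) [Field K] [Fintype K] (d : ℕ) :
    Fintype (Polynomial.degreeLT K d) :=
  Fintype.ofEquiv (Fin d → K) (Polynomial.degreeLTEquiv K d).toEquiv.symm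

/-- The variables `x i j` (`Sum.inl (i, j)`) and `y i` (`Sum.inr i`), with `i, j < n`. -/
abbrev NWVar (n : ℕ) : Type := (Fin n × Fin n) ⊕ Fin n

/-- `NW_{t,n}`, the sum over all `f ∈ K[z]` with `deg f < ⌊n / (2t)⌋` of the monomials
`∏ i, x_{i, f(i)}`, where `K` is a field with `n` elements and `e` identifies `[n]` with `K`.
The zero polynomial has degree `-∞`, so it always contributes. -/
noncomputable def NWt (F : Type*) [Field F] {n : ℕ} {K : Type*} [Field K] [Fintype K]
    (e : Fin n ≃ K) (t : ℕ) : MvPolynomial (NWVar n) F :=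
  ∑ f : Polynomial.degreeLT K (n / (2 * t)),
    ∏ i : Fin n, MvPolynomial.X (Sum.inl (i, e.symm ((f : Polynomial K).eval (e i))))

/-- `NW_n = ∑_{t = 1}^n y_t * NW_{t,n}`; the index `t = 1, …, n` is `i + 1` with `i : Fin n`. -/
noncomputable def NW (F : Type*) [Field F] {n : ℕ} {K : Type*} [Field K] [Fintype K]
    (e : Fin n ≃ K) : MvPolynomial (NWVar n) F :=
  ∑ i : Fin n, MvPolynomial.X (Sum.inr i) * NWt F e ((i : ℕ) + 1)

/-- The prime powers `p ^ k`, `k ≥ 1`: the sizes of finite fields. -/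
def primePowers : Set ℕ := {n | IsPrimePow n}

/-! Lower bound. A circuit of size `s` gives a sum of at most `s` scaled products whose homogeneous
factors have at most `s` monomials each and share one degree multiset `D`, with sum `n + 1`. Put `T
= ⌊√n⌋`; let `W` be the sum of the degrees in `D` that are at most `T`, and `B` the sum of the
others. Uniformity makes `W` and `B` the same for all products, so one case distinction serves the
whole circuit.

If `W < n / 10`, count monomials: the small factors of a product contribute at most `(n² + n + 1) ^
W`, and the at most `(n + 1) / T` large ones at most `s` each, whereas `NW` has at least `n ^ (n /
2)` monomials, from `t = 1` alone (`exp_sqrt_le_of_card_bound`).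

If `W ≥ n / 10`, use shifted coefficients at `t = 20 T`, `k = n / (2t)`. For each `f` of degree
below `k`, set `y_t = 1` and the other `y` to `0`, replace `x_{i,f(i)}` by a new variable `X` and
the other `x_{i,j}` by `0` in the first `k` blocks, and take the coefficient of `X ^ k`. This
replaces a partial derivative and works in every characteristic. On `NW` it leaves a single
monomial, and monomials of distinct `f` differ in at least `n - 2k` places, so their multiples by
monomials of degree at most `l` overlap little (`card_union_add_ge`, `card_inter_shift_le`). On a
product, the small factors are grouped into at most `W / T + 1` factors of degree at most `2T`, the
large ones are absorbed into the shift, and the result lies in a span of few generators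
(`IsUniformSum.exists_spanning`). Comparing dimensions for a suitable `l` gives `s ≥ exp(√n)`.

Membership in `VNP`. The coefficients of `f` are guessed as one-hot rows of an `n × n` bit matrix;
arithmetic in the finite field is hard-wired into a dynamic program that evaluates `f` at each
point. -/

section LowerBoundAndVNP

open Finset

/-! ### Monomials, variables and degree of the Nisan–Wigderson polynomials -/

section NisanWigderson

variable {n : ℕ} {K : Type*} [Field K]

/-- The exponent of the monomial `y_t * ∏ i, x_{i, f(i)}`. -/
noncomputable def nwExp (e : Fin n ≃ K) (t : Fin n) (f : Polynomial K) : NWVar n →₀ ℕ :=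
  Finsupp.single (Sum.inr t) 1 +
    ∑ i : Fin n, Finsupp.single (Sum.inl (i, e.symm (f.eval (e i)))) 1

theorem nwExp_inr (e : Fin n ≃ K) (t t' : Fin n) (f : Polynomial K) :
    nwExp e t f (Sum.inr t') = if t = t' then 1 else 0 := by
  simp [nwExp, Finsupp.single_apply]

theorem nwExp_inl (e : Fin n ≃ K) (t : Fin n) (f : Polynomial K) (i j : Fin n) :
    nwExp e t f (Sum.inl (i, j)) = if e.symm (f.eval (e i)) = j then 1 else 0 := by
  classical
  simp only [nwExp, Finsupp.add_apply, Finsupp.finsetSum_apply, Finsupp.single_apply]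
  rw [Finset.sum_eq_single i]
  · simp
  · intro b _ hb
    simp [hb]
  · simp

theorem degree_nwExp (e : Fin n ≃ K) (t : Fin n) (f : Polynomial K) :
    (nwExp e t f).degree = n + 1 := by
  simp [nwExp, map_sum, add_comm]

theorem eq_of_eval_eq_of_degree_lt (e : Fin n ≃ K) {f g : Polynomial K} (s : Finset (Fin n))
    {d : ℕ} (hfd : f.degree < d) (hgd : g.degree < d) (hd : d ≤ #s)
    (h : ∀ i ∈ s, f.eval (e i) = g.eval (e i)) : f = g := by
  classical
  refine Polynomial.eq_of_degrees_lt_of_eval_finset_eq (s.map e.toEmbedding) ?_ ?_ ?_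
  · rw [card_map]; exact hfd.trans_le (by exact_mod_cast hd)
  · rw [card_map]; exact hgd.trans_le (by exact_mod_cast hd)
  · intro x hx
    obtain ⟨i, hi, rfl⟩ := mem_map.1 hx
    exact h i hi

/-- The `y` variable records `t`, and the `n` values determine a polynomial of degree below `n`.
Hence no two terms of `NW` merge and nothing cancels in any characteristic. -/
theorem nwExp_injective (e : Fin n ≃ K) {t t' : Fin n} {f g : Polynomial K}
    (hf : f.degree < n) (hg : g.degree < n) (h : nwExp e t f = nwExp e t' g) :
    t = t' ∧ f = g := by
  constructor
  · have := DFunLike.congr_fun h (Sum.inr t')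
    rw [nwExp_inr, nwExp_inr] at this
    by_contra hne
    simp [hne] at this
  · refine eq_of_eval_eq_of_degree_lt e univ hf hg (by simp) fun i _ => ?_
    have := DFunLike.congr_fun h (Sum.inl (i, e.symm (g.eval (e i))))
    rw [nwExp_inl, nwExp_inl] at this
    by_contra hne
    simp [hne] at this

theorem degree_lt_of_mem_degreeLT {t : ℕ} (f : Polynomial.degreeLT K (n / (2 * t))) :
    (f : Polynomial K).degree < n :=
  (Polynomial.mem_degreeLT.1 f.2).trans_le (by exact_mod_cast Nat.div_le_self _ _)

variable [Fintype K]

theorem NWt_eq (F : Type*) [Field F] (e : Fin n ≃ K) (t : ℕ) :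
    NWt F e t = ∑ f : Polynomial.degreeLT K (n / (2 * t)),
      MvPolynomial.monomial
        (∑ i : Fin n, Finsupp.single (Sum.inl (i, e.symm ((f : Polynomial K).eval (e i)))) 1) 1 := by
  unfold NWt
  refine sum_congr rfl fun f _ => ?_
  rw [MvPolynomial.monomial_sum_one]
  rfl

theorem NW_eq (F : Type*) [Field F] (e : Fin n ≃ K) :
    NW F e = ∑ x : (Σ t : Fin n, Polynomial.degreeLT K (n / (2 * ((t : ℕ) + 1)))),
      MvPolynomial.monomial (nwExp e x.1 (x.2 : Polynomial K)) 1 := by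
  rw [Fintype.sum_sigma]
  unfold NW
  refine sum_congr rfl fun t _ => ?_
  rw [NWt_eq, mul_sum]
  refine sum_congr rfl fun f _ => ?_
  rw [MvPolynomial.X, MvPolynomial.monomial_mul, one_mul]
  rfl

omit [Fintype K] in
theorem nwExp_sigma_injective (e : Fin n ≃ K) :
    Function.Injective fun x : (Σ t : Fin n, Polynomial.degreeLT K (n / (2 * ((t : ℕ) + 1)))) =>
      nwExp e x.1 (x.2 : Polynomial K) := by
  rintro ⟨t, f⟩ ⟨t', g⟩ h
  obtain ⟨rfl, h2⟩ := nwExp_injective e (degree_lt_of_mem_degreeLT f)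
    (degree_lt_of_mem_degreeLT g) h
  congr 1
  exact Subtype.ext h2

theorem support_NW (F : Type*) [Field F] (e : Fin n ≃ K) :
    (NW F e).support = univ.map ⟨_, nwExp_sigma_injective e⟩ := by
  classical
  ext m
  rw [NW_eq, MvPolynomial.mem_support_iff, MvPolynomial.coeff_sum]
  simp only [MvPolynomial.coeff_monomial, mem_map, mem_univ, true_and, Function.Embedding.coeFn_mk]
  constructor
  · intro h
    obtain ⟨x, -, hx⟩ := exists_ne_zero_of_sum_ne_zero h
    exact ⟨x, by by_contra hne; simp [hne] at hx⟩
  · rintro ⟨x, rfl⟩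
    rw [sum_eq_single x]
    · simp
    · intro y _ hy
      rw [if_neg fun h => hy (nwExp_sigma_injective e h)]
    · simp

theorem NW_isHomogeneous (F : Type*) [Field F] (e : Fin n ≃ K) :
    (NW F e).IsHomogeneous (n + 1) := by
  rw [NW_eq]
  refine MvPolynomial.IsHomogeneous.sum _ _ _ fun x _ => ?_
  exact MvPolynomial.isHomogeneous_monomial _ (degree_nwExp e _ _)

theorem card_degreeLT (e : Fin n ≃ K) (d : ℕ) : Fintype.card (Polynomial.degreeLT K d) = n ^ d := by
  rw [Fintype.card_congr (Polynomial.degreeLTEquiv K d).toEquiv]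
  simp [← Fintype.card_congr e]

/-- The variable `x_{i,j}` occurs through the constant polynomial `e j` at `t = 1`, which is
admissible because `n / 2 ≥ 1`; `y_t` occurs through the zero polynomial, which is always
admissible. -/
theorem vars_NW (F : Type*) [Field F] (e : Fin n ≃ K) (hn : 2 ≤ n) : (NW F e).vars = univ := by
  classical
  ext v
  simp only [MvPolynomial.mem_vars_iff_mem_support, support_NW, mem_univ, iff_true, mem_map, true_and,
    Function.Embedding.coeFn_mk, exists_exists_eq_and, Finsupp.mem_support_iff]
  rcases v with ⟨i, j⟩ | t
  · refine ⟨⟨⟨0, by omega⟩, ⟨Polynomial.C (e j), ?_⟩⟩, ?_⟩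
    · rw [Polynomial.mem_degreeLT]
      refine Polynomial.degree_C_le.trans_lt ?_
      have : 0 < n / (2 * (0 + 1)) := by omega
      exact_mod_cast this
    · simp [nwExp_inl]
  · exact ⟨⟨t, 0⟩, by simp [nwExp_inr]⟩

theorem card_support_NW_ge (F : Type*) [Field F] (e : Fin n ≃ K) (hn : 2 ≤ n) :
    n ^ (n / 2) ≤ #(NW F e).support := by
  rw [support_NW, card_map, card_univ, Fintype.card_sigma]
  refine le_trans ?_ (single_le_sum (fun _ _ => Nat.zero_le _) (mem_univ ⟨0, by omega⟩))
  simp [card_degreeLT e]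

theorem NW_ne_zero (F : Type*) [Field F] (e : Fin n ≃ K) (hn : 2 ≤ n) : NW F e ≠ 0 := by
  intro h
  have := card_support_NW_ge F e hn
  rw [h] at this
  simp at this
  omega

end NisanWigderson

/-! ### Counting monomials and their shifts -/

section MonomialCount

/-- The exponents of the monomials of degree at most `L`. -/
noncomputable def expLE (σ : Type*) [Fintype σ] (L : ℕ) : Finset (σ →₀ ℕ) := by
  classical exact (range (L + 1)).biUnion fun j => finsuppAntidiag univ j

variable {σ : Type*} [Fintype σ]

theorem mem_expLE {L : ℕ} {m : σ →₀ ℕ} : m ∈ expLE σ L ↔ m.degree ≤ L := by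
  classical
  simp only [expLE, mem_biUnion, mem_range, mem_finsuppAntidiag, subset_univ, and_true,
    Finsupp.degree_eq_sum]
  constructor
  · rintro ⟨a, ha, h⟩
    exact h.trans_le (by omega)
  · exact fun h => ⟨_, Nat.lt_succ_of_le h, rfl⟩

theorem card_expLE (L : ℕ) : #(expLE σ L) = (Fintype.card σ + L).choose L := by
  classical
  rw [expLE, card_biUnion]
  · induction L with
    | zero => simp [card_finsuppAntidiag_nat_eq_choose]
    | succ L ih =>
      rw [sum_range_succ, ih, card_finsuppAntidiag_nat_eq_choose, card_univ]
      have : Fintype.card σ + (L + 1) - 1 = Fintype.card σ + L := by omega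
      rw [this, ← add_assoc, Nat.choose_succ_succ]
  · intro i _ j _ hij
    rw [Function.onFun, disjoint_left]
    intro m h1 h2
    rw [mem_finsuppAntidiag] at h1 h2
    exact hij (h1.1.symm.trans h2.1)

theorem choose_add_succ_mul (N L : ℕ) :
    (N + (L + 1)).choose (L + 1) * (L + 1) = (N + L).choose L * (N + L + 1) := by
  have := Nat.add_one_mul_choose_eq (N + L) L
  rw [← add_assoc]
  linarith

/-- Consecutive values of `(N + j).choose j` have ratio `1 + N / j`, which decreases in `j`. So `e`
steps up from `L` gain at most `(1 + N / L) ^ e`; the next lemma bounds the gain from below by the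
last ratio. -/
theorem choose_add_le_pow_mul (N L e : ℕ) (hL : 0 < L) :
    ((N + (L + e)).choose (L + e) : ℝ) ≤ (1 + N / L : ℝ) ^ e * (N + L).choose L := by
  induction e with
  | zero => simp
  | succ e ih =>
    have h := choose_add_succ_mul N (L + e)
    have hR : ((N + (L + (e + 1))).choose (L + (e + 1)) : ℝ) * (L + e + 1) =
        (N + (L + e)).choose (L + e) * (N + (L + e) + 1) := by exact_mod_cast h
    have hL' : (0 : ℝ) < L := by exact_mod_cast hL
    have hp : (0 : ℝ) < L + e + 1 := by positivity
    rw [eq_comm, ← div_eq_iff hp.ne'] at hR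
    rw [← hR, pow_succ, div_le_iff₀ hp]
    have h2 : (N + (L + e) + 1 : ℝ) ≤ (1 + N / L) * (L + e + 1) := by
      have : (N : ℝ) = N / L * L := by field_simp
      have h0 : (0 : ℝ) ≤ N / L * (e + 1) := by positivity
      nlinarith
    calc ((N + (L + e)).choose (L + e) : ℝ) * (N + (L + e) + 1)
        ≤ ((1 + N / L : ℝ) ^ e * (N + L).choose L) * ((1 + N / L) * (L + e + 1)) :=
          mul_le_mul ih h2 (by positivity) (by positivity)
      _ = _ := by ring

theorem pow_mul_choose_le (N L d : ℕ) (hL : 0 < L + d) :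
    (1 + N / (L + d : ℕ) : ℝ) ^ d * (N + L).choose L ≤ ((N + (L + d)).choose (L + d) : ℝ) := by
  induction d generalizing L with
  | zero => simp
  | succ d ih =>
    have h := ih (L + 1) (by omega)
    have e1 : L + 1 + d = L + (d + 1) := by ring
    rw [e1] at h
    refine le_trans ?_ h
    rw [pow_succ, mul_assoc]
    refine mul_le_mul_of_nonneg_left ?_ (by positivity)
    have h := choose_add_succ_mul N L
    have hR : ((N + (L + 1)).choose (L + 1) : ℝ) * (L + 1) =
        (N + L).choose L * (N + L + 1) := by exact_mod_cast h
    have hp : (0 : ℝ) < L + 1 := by positivity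
    have hc : (0 : ℝ) ≤ (N + L).choose L := by positivity
    have hq : (N / (L + (d + 1) : ℕ) : ℝ) * (L + 1) ≤ N := by
      push_cast
      rw [div_mul_eq_mul_div, div_le_iff₀ (by positivity)]
      have : (0 : ℝ) ≤ N * d := by positivity
      nlinarith
    refine le_of_mul_le_mul_right ?_ hp
    rw [hR]
    nlinarith

/-- A Bonferroni inequality with a crude count of the pairs, written without subtraction. -/
theorem card_union_add_ge {ι α : Type*} [DecidableEq α] (A : Finset ι)
    (U : ι → Finset α) (c x : ℕ) (hc : ∀ a ∈ A, #(U a) = c)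
    (hx : ∀ a ∈ A, ∀ b ∈ A, a ≠ b → #(U a ∩ U b) ≤ x) :
    #A * c ≤ #(A.biUnion U) + #A ^ 2 * x := by
  classical
  induction A using Finset.induction_on with
  | empty => simp
  | insert a A ha ih =>
    have ih := ih (fun a h => hc a (mem_insert_of_mem h))
      (fun a h b h' => hx a (mem_insert_of_mem h) b (mem_insert_of_mem h'))
    rw [biUnion_insert, card_insert_of_notMem ha]
    have h1 := card_union_add_card_inter (U a) (A.biUnion U)
    have h2 : #(U a ∩ A.biUnion U) ≤ #A * x := by
      rw [inter_biUnion]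
      refine card_biUnion_le.trans ?_
      rw [← smul_eq_mul]
      refine sum_le_card_nsmul _ _ _ fun b hb => ?_
      exact hx a (mem_insert_self _ _) b (mem_insert_of_mem hb) (by rintro rfl; exact ha hb)
    rw [hc a (mem_insert_self _ _)] at h1
    have h3 : (#A + 1) ^ 2 * x = #A ^ 2 * x + 2 * (#A * x) + x := by ring
    rw [h3, add_mul]
    omega

/-- A common multiple of the monomials `α` and `β` is `α` times a multiple of `β - α` (truncated),
which uses up at least `d` of the degree available to the shift. -/
theorem card_inter_shift_le [DecidableEq σ] (α β : σ →₀ ℕ) (l d : ℕ)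
    (hd : d ≤ (β - α).degree) :
    #((expLE σ l).image (α + ·) ∩ (expLE σ l).image (β + ·)) ≤ #(expLE σ (l - d)) := by
  classical
  refine (card_le_card (t := (expLE σ (l - d)).image (α + (β - α) + ·)) ?_).trans card_image_le
  intro m hm
  simp only [mem_inter, mem_image, mem_expLE] at hm ⊢
  obtain ⟨⟨γ, hγ, rfl⟩, γ', -, h⟩ := hm
  have hle : β - α ≤ γ := by
    rw [tsub_le_iff_left, ← h]
    exact le_self_add
  obtain ⟨δ, rfl⟩ := le_iff_exists_add.1 hle
  refine ⟨δ, ?_, by rw [add_assoc]⟩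
  rw [map_add] at hγ
  omega

end MonomialCount

/-! ### From depth four circuits to sums of products of sparse factors -/

namespace ArithCircuit

variable {F σ : Type*} [CommSemiring F] (C : ArithCircuit F σ)

theorem value_of_const {v : C.Node} {c : F} (h : C.gate v = .const c) :
    C.value v = MvPolynomial.C c := by
  rw [value_eq, h]; rfl

theorem value_of_var {v : C.Node} {x : σ} (h : C.gate v = .var x) :
    C.value v = MvPolynomial.X x := by
  rw [value_eq, h]; rfl

theorem value_of_add {v : C.Node} {s : Multiset C.Node} (h : C.gate v = .add s) :
    C.value v = (s.map C.value).sum := by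
  rw [value_eq, h]
  exact congrArg Multiset.sum (Multiset.attach_map_val' s C.value)

theorem value_of_mul {v : C.Node} {s : Multiset C.Node} (h : C.gate v = .mul s) :
    C.value v = (s.map C.value).prod := by
  rw [value_eq, h]
  exact congrArg Multiset.prod (Multiset.attach_map_val' s C.value)

/-- Every variable of a computed polynomial is the label of a leaf. -/
theorem exists_gate_eq_var (v : C.Node) (x : σ) (hx : x ∈ (C.value v).vars) :
    ∃ w, C.gate w = .var x := by
  classical
  induction v using C.acyclic.induction with
  | _ v ih =>
    rcases h : C.gate v with c | y | s | s
    · rw [C.value_of_const h] at hx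
      simp at hx
    · rw [C.value_of_var h] at hx
      rcases subsingleton_or_nontrivial F with _ | _
      · rw [Subsingleton.elim (MvPolynomial.X y : MvPolynomial σ F) 0] at hx
        simp at hx
      · rw [MvPolynomial.vars_X, mem_singleton] at hx
        exact ⟨v, hx ▸ h⟩
    · rw [C.value_of_add h] at hx
      have hin : ∀ w ∈ s, w ∈ (C.gate v).inputs := by rw [h]; exact fun w hw => hw
      have key : ∀ t : Multiset C.Node, t ≤ s → x ∈ ((t.map C.value).sum).vars →
          ∃ w, C.gate w = .var x := by
        intro t
        induction t using Multiset.induction_on with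
        | empty => simp
        | cons a t iht =>
          intro hle hmem
          rw [Multiset.map_cons, Multiset.sum_cons] at hmem
          rcases mem_union.1 (MvPolynomial.vars_add_subset _ _ hmem) with h1 | h1
          · exact ih a (hin a (Multiset.mem_of_le hle (Multiset.mem_cons_self a t))) h1
          · exact iht ((Multiset.le_cons_self t a).trans hle) h1
      exact key s le_rfl hx
    · rw [C.value_of_mul h] at hx
      have hin : ∀ w ∈ s, w ∈ (C.gate v).inputs := by rw [h]; exact fun w hw => hw
      have key : ∀ t : Multiset C.Node, t ≤ s → x ∈ ((t.map C.value).prod).vars →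
          ∃ w, C.gate w = .var x := by
        intro t
        induction t using Multiset.induction_on with
        | empty => simp
        | cons a t iht =>
          intro hle hmem
          rw [Multiset.map_cons, Multiset.prod_cons] at hmem
          rcases mem_union.1 (MvPolynomial.vars_mul _ _ hmem) with h1 | h1
          · exact ih a (hin a (Multiset.mem_of_le hle (Multiset.mem_cons_self a t))) h1
          · exact iht ((Multiset.le_cons_self t a).trans hle) h1
      exact key s le_rfl hx

/-- This crude bound settles the small values of `n` in the main theorem. -/
theorem card_vars_le_size : #C.poly.vars ≤ C.size := by
  classical
  choose g hg using fun x : C.poly.vars => C.exists_gate_eq_var C.output x x.2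
  rw [size, ← Fintype.card_coe]
  refine Fintype.card_le_of_injective g fun x y hxy => ?_
  have h1 := hg x
  rw [hxy, hg y] at h1
  exact Subtype.ext (Gate.var.inj h1).symm

/-- The value of a product of leaves is a scalar multiple of a monomial. -/
theorem exists_value_eq_monomial {w : C.Node} (hw : C.IsMul w)
    (hl : ∀ l ∈ C.inputs w, C.IsLeaf l) : ∃ m c, C.value w = MvPolynomial.monomial m c := by
  obtain ⟨s, hs⟩ := hw
  rw [C.value_of_mul hs]
  have hl : ∀ l ∈ s, C.IsLeaf l := by
    intro l h; apply hl; rw [inputs, hs]; exact h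
  clear hs
  induction s using Multiset.induction_on with
  | empty => exact ⟨0, 1, by simp⟩
  | cons a s ih =>
    obtain ⟨m, c, h⟩ := ih fun l h => hl l (Multiset.mem_cons_of_mem h)
    rw [Multiset.map_cons, Multiset.prod_cons, h]
    rcases hl a (Multiset.mem_cons_self a s) with ⟨b, hb⟩ | ⟨x, hx⟩
    · rw [C.value_of_const hb, MvPolynomial.C_mul_monomial]
      exact ⟨_, _, rfl⟩
    · rw [C.value_of_var hx, MvPolynomial.X, MvPolynomial.monomial_mul]
      exact ⟨_, _, rfl⟩

/-- A sum of products of leaves has at most as many monomials as the circuit has nodes. -/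
theorem card_support_le_size {v : C.Node} (hv : C.IsAdd v)
    (hw : ∀ w ∈ C.inputs v, C.IsMul w ∧ ∀ l ∈ C.inputs w, C.IsLeaf l) :
    #(C.value v).support ≤ C.size := by
  classical
  obtain ⟨s, hs⟩ := hv
  have hw : ∀ w ∈ s, C.IsMul w ∧ ∀ l ∈ C.inputs w, C.IsLeaf l := by
    intro l h; apply hw; rw [inputs, hs]; exact h
  have hsub : (C.value v).support ⊆ s.toFinset.biUnion fun w => (C.value w).support := by
    rw [C.value_of_add hs]
    clear hw hs
    induction s using Multiset.induction_on with
    | empty => simp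
    | cons a s ih =>
      rw [Multiset.map_cons, Multiset.sum_cons]
      refine MvPolynomial.support_add.trans (union_subset ?_ (ih.trans ?_))
      · exact subset_biUnion_of_mem (fun w => (C.value w).support) (by simp)
      · exact biUnion_subset_biUnion_of_subset_left _ (by simp)
  refine (card_le_card hsub).trans (card_biUnion_le.trans ?_)
  refine (sum_le_card_nsmul _ _ 1 fun w hws => ?_).trans ?_
  · obtain ⟨m, c, h⟩ := C.exists_value_eq_monomial (hw w (Multiset.mem_toFinset.1 hws)).1
      (hw w (Multiset.mem_toFinset.1 hws)).2
    rw [h]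
    exact (card_le_card MvPolynomial.support_monomial_subset).trans (by simp)
  · rw [smul_eq_mul, mul_one]
    exact card_le_univ _

end ArithCircuit

/-- A list of the pairs given by a relation between multisets. -/
theorem Multiset.Rel.exists_pairs {α β : Type*} {r : α → β → Prop} {s : Multiset α}
    {t : Multiset β} (h : Multiset.Rel r s t) :
    ∃ P : Multiset (α × β), P.map Prod.fst = s ∧ P.map Prod.snd = t ∧ ∀ p ∈ P, r p.1 p.2 := by
  induction h with
  | zero => exact ⟨0, by simp⟩
  | @cons a b as bs hab _ ih =>
    obtain ⟨P, h1, h2, h3⟩ := ih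
    refine ⟨(a, b) ::ₘ P, by simp [h1], by simp [h2], ?_⟩
    intro p hp
    rcases Multiset.mem_cons.1 hp with rfl | hp
    · exact hab
    · exact h3 p hp

/-- The polynomial `p` is a sum of at most `s` scalar multiples of products, each of which is a
product of homogeneous factors with at most `s` monomials whose degrees form the multiset `D`. -/
structure IsUniformSum {F σ : Type*} [CommSemiring F] (D : Multiset ℕ) (s : ℕ)
    (p : MvPolynomial σ F) : Prop where
  exists_terms : ∃ (ι : Type) (_ : Fintype ι) (c : ι → F) (P : ι → Multiset (MvPolynomial σ F × ℕ)),
    Fintype.card ι ≤ s ∧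
    (∀ i, (P i).map Prod.snd = D) ∧
    (∀ i, ∀ q ∈ P i, q.1.IsHomogeneous q.2 ∧ #q.1.support ≤ s) ∧
    p = ∑ i, MvPolynomial.C (c i) * ((P i).map Prod.fst).prod

theorem ArithCircuit.IsHomogeneousSPSPStar.isUniformSum {F σ : Type*} [CommSemiring F]
    {C : ArithCircuit F σ} (h : C.IsHomogeneousSPSPStar) :
    ∃ D, IsUniformSum D C.size C.poly := by
  classical
  obtain ⟨-, ⟨⟨s, hs⟩, hlay⟩, D, hD⟩ := h
  have hin : C.inputs C.output = s := by rw [inputs, hs]; rfl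
  rw [hin] at hlay hD
  choose P hP1 hP2 hP3 using fun u : s.toFinset => (hD u (Multiset.mem_toFinset.1 u.2)).exists_pairs
  -- Parallel edges into the output are merged into a scalar coefficient, so the number of terms is
  -- at most the number of nodes, whatever the top fan-in.
  refine ⟨D, ⟨s.toFinset, inferInstance, fun u => (s.count u.1 : F),
    fun u => (P u).map fun p => (C.value p.1, p.2), ?_, ?_, ?_, ?_⟩⟩
  · rw [Fintype.card_coe]
    exact card_le_univ _
  · intro u
    rw [Multiset.map_map, ← hP2 u]
    rfl
  · intro u q hq
    obtain ⟨p, hp, rfl⟩ := Multiset.mem_map.1 hq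
    refine ⟨hP3 u p hp, ?_⟩
    have hmem : p.1 ∈ C.inputs u := by
      rw [← hP1 u]; exact Multiset.mem_map_of_mem _ hp
    obtain ⟨hadd, hbot⟩ := (hlay u (Multiset.mem_toFinset.1 u.2)).2 _ hmem
    exact C.card_support_le_size hadd hbot
  · rw [poly, C.value_of_add hs, Finset.sum_multiset_map_count,
      ← Finset.sum_coe_sort s.toFinset fun u => s.count u • C.value u]
    refine sum_congr rfl fun u _ => ?_
    obtain ⟨t, ht⟩ := (hlay u (Multiset.mem_toFinset.1 u.2)).1
    have hu : C.inputs u = t := by rw [inputs, ht]; rfl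
    rw [C.value_of_mul ht, nsmul_eq_mul, Multiset.map_map, ← hu, ← hP1 u, Multiset.map_map]
    simp only [Function.comp_def, map_natCast]

/-! ### Upper bound on the number of monomials of a uniform sum -/

section MonomialBound

variable {F σ : Type*}

theorem choose_add_le_pow (N W : ℕ) : (N + W).choose W ≤ (N + 1) ^ W := by
  induction W with
  | zero => simp
  | succ W ih =>
    refine Nat.le_of_mul_le_mul_right ?_ (Nat.succ_pos W)
    rw [Nat.succ_eq_add_one, choose_add_succ_mul, pow_succ, mul_assoc]
    exact Nat.mul_le_mul ih (by nlinarith)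

theorem MvPolynomial.IsHomogeneous.card_support_le [CommSemiring F] [Fintype σ]
    {q : MvPolynomial σ F} {d : ℕ} (h : q.IsHomogeneous d) :
    #q.support ≤ (Fintype.card σ + 1) ^ d := by
  refine le_trans (card_le_card (t := expLE σ d) fun m hm => ?_)
    ((card_expLE d).trans_le (choose_add_le_pow _ _))
  rw [mem_expLE]
  refine le_trans ?_ h.totalDegree_le
  rw [Finsupp.degree_apply]
  exact MvPolynomial.le_totalDegree hm

theorem MvPolynomial.card_support_mul_le [CommSemiring F] (p q : MvPolynomial σ F) :
    #(p * q).support ≤ #p.support * #q.support := by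
  classical
  exact (card_le_card (MvPolynomial.support_mul p q)).trans card_add_le

theorem MvPolynomial.card_support_multiset_prod_le [CommSemiring F]
    {α : Type*} (P : Multiset α) (f : α → MvPolynomial σ F) (b : α → ℕ)
    (h : ∀ q ∈ P, #(f q).support ≤ b q) :
    #((P.map f).prod).support ≤ (P.map b).prod := by
  induction P using Multiset.induction_on with
  | empty =>
    simp only [Multiset.map_zero, Multiset.prod_zero]
    rw [← MvPolynomial.C_1]
    exact (card_le_card MvPolynomial.support_monomial_subset).trans (by simp)
  | cons a P ih =>
    rw [Multiset.map_cons, Multiset.prod_cons, Multiset.map_cons, Multiset.prod_cons]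
    exact (card_support_mul_le _ _).trans (Nat.mul_le_mul (h a (Multiset.mem_cons_self a P))
      (ih fun q hq => h q (Multiset.mem_cons_of_mem hq)))

theorem Multiset.prod_map_ite_le_eq (D : Multiset ℕ) (T a s : ℕ) :
    (D.map fun d => if d ≤ T then a ^ d else s).prod =
      a ^ (D.filter (· ≤ T)).sum * s ^ (D.filter (¬ · ≤ T)).card := by
  induction D using Multiset.induction_on with
  | empty => simp
  | cons d D ih =>
    rw [Multiset.map_cons, Multiset.prod_cons, ih]
    by_cases h : d ≤ T
    · rw [if_pos h, Multiset.filter_cons_of_pos (p := (· ≤ T)) _ h,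
        Multiset.filter_cons_of_neg (p := (¬ · ≤ T)) _ (not_not.2 h), Multiset.sum_cons, pow_add]
      ring
    · rw [if_neg h, Multiset.filter_cons_of_neg (p := (· ≤ T)) _ h,
        Multiset.filter_cons_of_pos (p := (¬ · ≤ T)) _ h, Multiset.card_cons, pow_succ]
      ring

theorem Multiset.mul_card_filter_le (D : Multiset ℕ) (T : ℕ) :
    T * (D.filter (¬ · ≤ T)).card ≤ D.sum := by
  induction D using Multiset.induction_on with
  | empty => simp
  | cons d D ih =>
    by_cases h : d ≤ T
    · rw [Multiset.filter_cons_of_neg (p := (¬ · ≤ T)) _ (not_not.2 h), Multiset.sum_cons]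
      omega
    · rw [Multiset.filter_cons_of_pos (p := (¬ · ≤ T)) _ h, Multiset.sum_cons, Multiset.card_cons,
        mul_add]
      omega

/-- A factor of degree `d ≤ T` is bounded by the number of all monomials of degree at most `d`, a
factor of larger degree by its sparsity `s`. -/
theorem IsUniformSum.card_support_le [CommSemiring F] [Fintype σ] {D : Multiset ℕ} {s : ℕ}
    {p : MvPolynomial σ F} (h : IsUniformSum D s p) (T : ℕ) :
    #p.support ≤ s * ((Fintype.card σ + 1) ^ (D.filter (· ≤ T)).sum *
      s ^ (D.filter (¬ · ≤ T)).card) := by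
  classical
  obtain ⟨ι, _, c, P, hι, hD, hP, rfl⟩ := h.exists_terms
  refine (card_le_card MvPolynomial.support_sum).trans (card_biUnion_le.trans ?_)
  refine (sum_le_card_nsmul _ _
    ((D.map fun d => if d ≤ T then (Fintype.card σ + 1) ^ d else s).prod) fun i _ => ?_).trans ?_
  · refine (MvPolynomial.card_support_mul_le _ _).trans ?_
    have h1 : #(MvPolynomial.C (σ := σ) (c i)).support ≤ 1 :=
      (card_le_card MvPolynomial.support_monomial_subset).trans (by simp)
    refine (Nat.mul_le_mul h1 le_rfl).trans ?_
    rw [one_mul, ← hD i, Multiset.map_map]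
    refine MvPolynomial.card_support_multiset_prod_le _ _ _ fun q hq => ?_
    dsimp only [Function.comp]
    split_ifs
    · exact (hP i q hq).1.card_support_le
    · exact (hP i q hq).2
  · rw [smul_eq_mul, card_univ, Multiset.prod_map_ite_le_eq]
    exact Nat.mul_le_mul hι le_rfl

end MonomialBound

/-! ### Degrees of coefficients under substitution -/

section CoefficientDegree

variable {F σ Z : Type*} [Field F]

/-- All coefficients of `P` have total degree at most `d`. -/
def CoeffDegreeLE (P : Polynomial (MvPolynomial Z F)) (d : ℕ) : Prop :=
  ∀ i, (P.coeff i).totalDegree ≤ d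

theorem CoeffDegreeLE.mono {P : Polynomial (MvPolynomial Z F)} {d d' : ℕ}
    (h : CoeffDegreeLE P d) (hd : d ≤ d') : CoeffDegreeLE P d' := fun i => (h i).trans hd

theorem CoeffDegreeLE.mul {P Q : Polynomial (MvPolynomial Z F)} {d d' : ℕ}
    (hP : CoeffDegreeLE P d) (hQ : CoeffDegreeLE Q d') : CoeffDegreeLE (P * Q) (d + d') := by
  intro i
  rw [Polynomial.coeff_mul]
  refine MvPolynomial.totalDegree_finsetSum_le fun x _ => ?_
  exact (MvPolynomial.totalDegree_mul _ _).trans (add_le_add (hP _) (hQ _))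

theorem coeffDegreeLE_one : CoeffDegreeLE (1 : Polynomial (MvPolynomial Z F)) 0 := by
  intro i
  rw [Polynomial.coeff_one]
  split_ifs <;> simp

theorem CoeffDegreeLE.pow {P : Polynomial (MvPolynomial Z F)} {d : ℕ}
    (hP : CoeffDegreeLE P d) (j : ℕ) : CoeffDegreeLE (P ^ j) (j * d) := by
  induction j with
  | zero => simpa using coeffDegreeLE_one
  | succ j ih =>
    rw [pow_succ, add_mul, one_mul]
    exact ih.mul hP

theorem CoeffDegreeLE.prod {ι : Type*} (s : Finset ι) {P : ι → Polynomial (MvPolynomial Z F)}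
    {d : ι → ℕ} (hP : ∀ i ∈ s, CoeffDegreeLE (P i) (d i)) :
    CoeffDegreeLE (∏ i ∈ s, P i) (∑ i ∈ s, d i) := by
  classical
  induction s using Finset.induction_on with
  | empty => simpa using coeffDegreeLE_one
  | insert a s ha ih =>
    rw [prod_insert ha, sum_insert ha]
    exact (hP a (mem_insert_self a s)).mul (ih fun i hi => hP i (mem_insert_of_mem hi))

theorem CoeffDegreeLE.sum {ι : Type*} (s : Finset ι) {P : ι → Polynomial (MvPolynomial Z F)}
    {d : ℕ} (hP : ∀ i ∈ s, CoeffDegreeLE (P i) d) : CoeffDegreeLE (∑ i ∈ s, P i) d := by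
  intro j
  rw [Polynomial.finsetSum_coeff]
  exact MvPolynomial.totalDegree_finsetSum_le fun i hi => hP i hi j

/-- Degrees are measured in the surviving variables `Z` only. A substitution whose coefficients have
degree at most 1 does not raise them. -/
theorem coeffDegreeLE_aeval {g : σ → Polynomial (MvPolynomial Z F)}
    (hg : ∀ v, CoeffDegreeLE (g v) 1) (Q : MvPolynomial σ F) :
    CoeffDegreeLE (MvPolynomial.aeval g Q) Q.totalDegree := by
  rw [MvPolynomial.aeval_def, MvPolynomial.eval₂_eq]
  refine CoeffDegreeLE.sum _ fun m hm => ?_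
  have hc : CoeffDegreeLE (algebraMap F (Polynomial (MvPolynomial Z F)) (Q.coeff m)) 0 := by
    intro i
    rw [IsScalarTower.algebraMap_apply F (MvPolynomial Z F) (Polynomial (MvPolynomial Z F)),
      Polynomial.algebraMap_eq, Polynomial.coeff_C]
    split_ifs
    · simp [MvPolynomial.algebraMap_eq]
    · simp
  refine ((hc.mul (CoeffDegreeLE.prod _ fun v _ => (hg v).pow (m v)))).mono ?_
  simp only [mul_one, zero_add]
  exact MvPolynomial.le_totalDegree hm

theorem coeffDegreeLE_sub_C {P : Polynomial (MvPolynomial Z F)} {d : ℕ}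
    (hP : CoeffDegreeLE P d) : CoeffDegreeLE (P - Polynomial.C (P.coeff 0)) d := by
  intro i
  rw [Polynomial.coeff_sub, Polynomial.coeff_C]
  split_ifs with h
  · simp [h]
  · simpa using hP i

end CoefficientDegree

/-! ### Grouping factors of small degree -/

section Grouping

variable {F σ : Type*} [CommSemiring F]

/-- Factors of degree at most `T` can be multiplied together in groups of degree at most `2 * T`,
of which all but one have degree at least `T`. -/
theorem exists_grouping (T : ℕ) (P : Multiset (MvPolynomial σ F × ℕ))
    (hP : ∀ q ∈ P, q.1.totalDegree ≤ q.2 ∧ q.2 ≤ T) :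
    ∃ (q : MvPolynomial σ F × ℕ) (L : List (MvPolynomial σ F × ℕ)),
      ((q :: L).map Prod.fst).prod = (P.map Prod.fst).prod ∧
      ((q :: L).map Prod.snd).sum = (P.map Prod.snd).sum ∧
      (∀ x ∈ q :: L, x.1.totalDegree ≤ x.2 ∧ x.2 ≤ 2 * T) ∧
      L.length * T ≤ (P.map Prod.snd).sum := by
  suffices H : ∃ (q : MvPolynomial σ F × ℕ) (L : List (MvPolynomial σ F × ℕ)),
      ((q :: L).map Prod.fst).prod = (P.map Prod.fst).prod ∧
      ((q :: L).map Prod.snd).sum = (P.map Prod.snd).sum ∧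
      (∀ x ∈ q :: L, x.1.totalDegree ≤ x.2 ∧ x.2 ≤ 2 * T) ∧
      L.length * T ≤ (L.map Prod.snd).sum by
    obtain ⟨q, L, h1, h2, h3, h4⟩ := H
    refine ⟨q, L, h1, h2, h3, h4.trans ?_⟩
    rw [← h2, List.map_cons, List.sum_cons]
    omega
  induction P using Multiset.induction_on with
  | empty => exact ⟨(1, 0), [], by simp, by simp, by simp, by simp⟩
  | cons a P ih =>
    obtain ⟨q, L, h1, h2, h3, h4⟩ := ih fun q hq => hP q (Multiset.mem_cons_of_mem hq)
    obtain ⟨ha1, ha2⟩ := hP a (Multiset.mem_cons_self a P)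
    simp only [List.map_cons, List.prod_cons, List.sum_cons, List.mem_cons, forall_eq_or_imp,
      Multiset.map_cons, Multiset.prod_cons, Multiset.sum_cons] at *
    -- Here `q` is the open group. Up to degree `T` it can absorb another factor and stay within `2
    -- * T`; beyond `T` it is closed and pays for its place in the length bound.
    by_cases hq : q.2 ≤ T
    · refine ⟨(a.1 * q.1, a.2 + q.2), L, ?_, ?_, ⟨⟨?_, ?_⟩, h3.2⟩, h4⟩
      · rw [← h1]; ring
      · rw [← h2]; ring
      · exact (MvPolynomial.totalDegree_mul _ _).trans (add_le_add ha1 h3.1.1)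
      · dsimp only; omega
    · refine ⟨a, q :: L, ?_, ?_, ⟨⟨ha1, by omega⟩, ?_⟩, ?_⟩
      · simp only [List.map_cons, List.prod_cons]; rw [← h1]
      · simp only [List.map_cons, List.sum_cons]; rw [← h2]
      · simpa using h3
      · simp only [List.map_cons, List.sum_cons, List.length_cons, add_mul]
        omega

theorem Multiset.totalDegree_prod_le (P : Multiset (MvPolynomial σ F × ℕ))
    (hP : ∀ q ∈ P, q.1.totalDegree ≤ q.2) :
    ((P.map Prod.fst).prod).totalDegree ≤ (P.map Prod.snd).sum := by
  induction P using Multiset.induction_on with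
  | empty => simp
  | cons a P ih =>
    simp only [Multiset.map_cons, Multiset.prod_cons, Multiset.sum_cons]
    exact (MvPolynomial.totalDegree_mul _ _).trans (add_le_add (hP a (Multiset.mem_cons_self a P))
      (ih fun q hq => hP q (Multiset.mem_cons_of_mem hq)))

end Grouping

/-! ### Few generators for the shifted coefficients of a uniform sum -/

section ShiftedSpan

variable {F σ Z : Type*} [Field F] [Fintype Z]

/-- The products of subproducts of `q` with monomials of degree at most `L`. -/
noncomputable def shiftedProducts {m : ℕ} (q : Fin m → MvPolynomial Z F) (L : ℕ) :
    Finset (MvPolynomial Z F) := by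
  classical
  exact image₂ (fun S γ => (∏ j ∈ S, q j) * MvPolynomial.monomial γ 1)
    (univ : Finset (Fin m)).powerset (expLE Z L)

theorem card_shiftedProducts_le {m : ℕ} (q : Fin m → MvPolynomial Z F) (L : ℕ) :
    #(shiftedProducts q L) ≤ 2 ^ m * #(expLE Z L) := by
  classical
  unfold shiftedProducts
  refine (card_image₂_le _ _ _).trans ?_
  rw [card_powerset, card_univ, Fintype.card_fin]

theorem prod_mul_mem_span_shiftedProducts {m : ℕ} (q : Fin m → MvPolynomial Z F) {L : ℕ}
    (S : Finset (Fin m)) {p : MvPolynomial Z F} (hp : p.totalDegree ≤ L) :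
    (∏ j ∈ S, q j) * p ∈ Submodule.span F (shiftedProducts q L : Set (MvPolynomial Z F)) := by
  classical
  rw [p.as_sum, mul_sum]
  refine Submodule.sum_mem _ fun γ hγ => ?_
  have : (∏ j ∈ S, q j) * MvPolynomial.monomial γ (p.coeff γ) =
      p.coeff γ • ((∏ j ∈ S, q j) * MvPolynomial.monomial γ 1) := by
    rw [← mul_smul_comm, MvPolynomial.smul_monomial, smul_eq_mul, mul_one]
  rw [this]
  refine Submodule.smul_mem _ _ (Submodule.subset_span ?_)
  rw [mem_coe, shiftedProducts]
  refine mem_image₂_of_mem (mem_powerset.2 (subset_univ S)) (mem_expLE.2 (le_trans ?_ hp))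
  rw [Finsupp.degree_apply]
  exact MvPolynomial.le_totalDegree hγ

/-- The `k`-th coefficient of a product, after a substitution whose constant coefficients are
known, is a combination of shifted subproducts of the constant coefficients of the factors. -/
theorem mul_coeff_aeval_mem_span {g : σ → Polynomial (MvPolynomial Z F)}
    (hg : ∀ v, CoeffDegreeLE (g v) 1) {m : ℕ} (A : MvPolynomial σ F) (Q : Fin m → MvPolynomial σ F)
    (B k l : ℕ) (hQ : ∀ j, (Q j).totalDegree ≤ B) {r : MvPolynomial Z F} (hr : r.totalDegree ≤ l) :
    r * (MvPolynomial.aeval g (A * ∏ j, Q j)).coeff k ∈ Submodule.span F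
      (shiftedProducts (fun j => (MvPolynomial.aeval g (Q j)).coeff 0)
        (l + A.totalDegree + k * B) : Set (MvPolynomial Z F)) := by
  classical
  set R : Fin m → Polynomial (MvPolynomial Z F) := fun j => MvPolynomial.aeval g (Q j) -
    Polynomial.C ((MvPolynomial.aeval g (Q j)).coeff 0) with hR
  have hsplit : ∀ j, MvPolynomial.aeval g (Q j) =
      R j + Polynomial.C ((MvPolynomial.aeval g (Q j)).coeff 0) := fun j => by simp [hR]
  have hX : ∀ j, Polynomial.X ∣ R j := fun j => by
    rw [Polynomial.X_dvd_iff]; simp [hR]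
  rw [map_mul, map_prod, prod_congr rfl fun j _ => hsplit j, prod_add, mul_sum, Polynomial.finsetSum_coeff, mul_sum]
  refine Submodule.sum_mem _ fun S _ => ?_
  rw [← map_prod Polynomial.C, ← mul_assoc, Polynomial.coeff_mul_C]
  -- `S` is the set of factors from which the remainder `R j`, divisible by `X`, is taken. More than
  -- `k` remainders contribute nothing to the `k`-th coefficient; at most `k` of them add at most `k
  -- * B` to the degree.
  by_cases hS : #S ≤ k
  · rw [mul_comm _ (∏ j ∈ _, _), mul_left_comm]
    refine prod_mul_mem_span_shiftedProducts _ _ ?_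
    refine (MvPolynomial.totalDegree_mul _ _).trans ?_
    have h1 : CoeffDegreeLE (MvPolynomial.aeval g A * ∏ j ∈ S, R j)
        (A.totalDegree + ∑ _j ∈ S, B) :=
      (coeffDegreeLE_aeval hg A).mul (CoeffDegreeLE.prod _ fun j _ =>
        coeffDegreeLE_sub_C ((coeffDegreeLE_aeval hg (Q j)).mono (hQ j)))
    have h2 := h1 k
    rw [sum_const, smul_eq_mul] at h2
    have h3 : #S * B ≤ k * B := Nat.mul_le_mul_right _ hS
    omega
  · have hdvd : Polynomial.X ^ #S ∣ MvPolynomial.aeval g A * ∏ j ∈ S, R j := by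
      refine Dvd.dvd.mul_left ?_ _
      rw [← prod_const]
      exact prod_dvd_prod_of_dvd _ _ fun j _ => hX j
    rw [Polynomial.X_pow_dvd_iff.1 hdvd k (by omega), zero_mul, mul_zero]
    exact Submodule.zero_mem _

omit [Fintype Z] in
-- Taking the constant coefficient is a ring homomorphism, so it commutes with substitution. This
-- lets one set of generators serve all the substitutions `g a`.
theorem constantCoeff_aeval_eq {g g' : σ → Polynomial (MvPolynomial Z F)}
    (h : ∀ v, (g v).coeff 0 = (g' v).coeff 0) (Q : MvPolynomial σ F) :
    (MvPolynomial.aeval g Q).coeff 0 = (MvPolynomial.aeval g' Q).coeff 0 := by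
  have key : ∀ g : σ → Polynomial (MvPolynomial Z F), (MvPolynomial.aeval g Q).coeff 0 =
      MvPolynomial.aeval (fun v => (g v).coeff 0) Q := by
    intro g
    rw [MvPolynomial.aeval_def, MvPolynomial.aeval_def, MvPolynomial.eval₂_eq,
      MvPolynomial.eval₂_eq, ← Polynomial.constantCoeff_apply, map_sum]
    refine sum_congr rfl fun m _ => ?_
    rw [map_mul, map_prod]
    simp only [map_pow, Polynomial.constantCoeff_apply]
    congr 1
    rw [IsScalarTower.algebraMap_apply F (MvPolynomial Z F) (Polynomial (MvPolynomial Z F)),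
      Polynomial.algebraMap_eq, Polynomial.coeff_C_zero]
  rw [key, key]
  exact congrArg (fun f => MvPolynomial.aeval f Q) (funext h)

/-- Upper bound for the dimension spanned by shifts of coefficients of a uniform sum. -/
theorem IsUniformSum.exists_spanning {D : Multiset ℕ} {s : ℕ} {p : MvPolynomial σ F}
    (h : IsUniformSum D s p) {A : Type*} [Nonempty A] (g : A → σ → Polynomial (MvPolynomial Z F))
    (hg : ∀ a v, CoeffDegreeLE (g a v) 1) (hg0 : ∀ a b v, (g a v).coeff 0 = (g b v).coeff 0)
    (T k l : ℕ) (hT : 0 < T) :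
    ∃ G : Finset (MvPolynomial Z F),
      #G ≤ s * (2 ^ ((D.filter (· ≤ T)).sum / T + 1) *
        #(expLE Z (l + (D.filter (¬ · ≤ T)).sum + k * (2 * T)))) ∧
      ∀ a, ∀ r : MvPolynomial Z F, r.totalDegree ≤ l →
        r * (MvPolynomial.aeval (g a) p).coeff k ∈
          Submodule.span F (G : Set (MvPolynomial Z F)) := by
  classical
  obtain ⟨a₀⟩ := ‹Nonempty A›
  obtain ⟨ι, _, c, P, hι, hD, hP, rfl⟩ := h.exists_terms
  have hsmall : ∀ i, ((P i).filter (·.2 ≤ T)).map Prod.snd = D.filter (· ≤ T) := fun i => by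
    rw [← hD i, Multiset.filter_map]; rfl
  have hbig : ∀ i, ((P i).filter (¬ ·.2 ≤ T)).map Prod.snd = D.filter (¬ · ≤ T) := fun i => by
    rw [← hD i, Multiset.filter_map]; rfl
  choose q L h1 h2 h3 h4 using fun i => exists_grouping T ((P i).filter (·.2 ≤ T)) fun x hx =>
    ⟨(hP i x (Multiset.mem_of_mem_filter hx)).1.totalDegree_le, (Multiset.mem_filter.1 hx).2⟩
  let Q : (i : ι) → Fin (q i :: L i).length → MvPolynomial σ F := fun i j => ((q i :: L i).get j).1
  let big : ι → MvPolynomial σ F := fun i => (((P i).filter (¬ ·.2 ≤ T)).map Prod.fst).prod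
  have hprod : ∀ i, ((P i).map Prod.fst).prod = big i * ∏ j, Q i j := by
    intro i
    have e1 : ∏ j, Q i j = ((q i :: L i).map Prod.fst).prod :=
      Fin.prod_univ_fun_getElem (q i :: L i) Prod.fst
    rw [e1, h1 i, mul_comm, ← Multiset.prod_add, ← Multiset.map_add, Multiset.filter_add_not]
  have hbigdeg : ∀ i, (big i).totalDegree ≤ (D.filter (¬ · ≤ T)).sum := by
    intro i
    rw [← hbig i]
    exact Multiset.totalDegree_prod_le _ fun x hx =>
      (hP i x (Multiset.mem_of_mem_filter hx)).1.totalDegree_le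
  set E := l + (D.filter (¬ · ≤ T)).sum + k * (2 * T) with hE
  refine ⟨univ.biUnion fun i =>
    shiftedProducts (fun j => (MvPolynomial.aeval (g a₀) (Q i j)).coeff 0) E, ?_, ?_⟩
  · refine card_biUnion_le.trans ((sum_le_card_nsmul _ _ _ fun i _ => ?_).trans
      (Nat.mul_le_mul hι le_rfl))
    refine (card_shiftedProducts_le _ _).trans (Nat.mul_le_mul ?_ le_rfl)
    refine Nat.pow_le_pow_right (by norm_num) ?_
    rw [List.length_cons]
    have := h4 i
    rw [hsmall i] at this
    exact Nat.succ_le_succ ((Nat.le_div_iff_mul_le hT).2 this)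
  · intro a r hr
    rw [map_sum, Polynomial.finsetSum_coeff, mul_sum]
    refine Submodule.sum_mem _ fun i _ => ?_
    have hc : (MvPolynomial.aeval (g a) (MvPolynomial.C (c i) * ((P i).map Prod.fst).prod)).coeff k
        = MvPolynomial.C (c i) *
          (MvPolynomial.aeval (g a) ((P i).map Prod.fst).prod).coeff k := by
      rw [← MvPolynomial.smul_eq_C_mul, map_smul, Polynomial.coeff_smul,
        ← MvPolynomial.smul_eq_C_mul]
    rw [hc, ← MvPolynomial.smul_eq_C_mul, mul_smul_comm, hprod i]
    refine Submodule.smul_mem _ _ ?_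
    -- The large factors of a term may have degree below the sum of their labels, because zero
    -- factors carry arbitrary labels. The slack is given to `r`, so that all terms use the same
    -- `E`.
    have hm := mul_coeff_aeval_mem_span (hg a) (big i) (Q i) (2 * T) k
      (E - (big i).totalDegree - k * (2 * T)) (r := r)
      (fun j => (h3 i _ (List.get_mem _ _)).1.trans (h3 i _ (List.get_mem _ _)).2)
      (by have := hbigdeg i; omega)
    have hEE : E - (big i).totalDegree - k * (2 * T) + (big i).totalDegree + k * (2 * T) = E := by
      have := hbigdeg i; omega
    rw [hEE, show (fun j => (MvPolynomial.aeval (g a) (Q i j)).coeff 0) =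
      fun j => (MvPolynomial.aeval (g a₀) (Q i j)).coeff 0 from
        funext fun j => constantCoeff_aeval_eq (hg0 a a₀) _] at hm
    refine Submodule.span_mono ?_ hm
    exact_mod_cast subset_biUnion_of_mem
      (fun i => shiftedProducts (fun j => (MvPolynomial.aeval (g a₀) (Q i j)).coeff 0) E)
      (mem_univ i)

end ShiftedSpan

/-! ### Shifted coefficients of the Nisan–Wigderson polynomials -/

section NWShifted

variable {n : ℕ} {K : Type*} [Field K]

/-- The substitution that plugs `y_{t₀} = 1` and the other `y_t = 0`, and in the first `k` blocks
keeps, as one new variable, only the variables `x_{i, f(i)}`. -/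
noncomputable def nwSubst (F : Type*) [Field F] (e : Fin n ≃ K) (t₀ : Fin n) (k : ℕ)
    (f : Polynomial K) : NWVar n → Polynomial (MvPolynomial (Fin n × Fin n) F)
  | Sum.inl (i, j) => if (i : ℕ) < k then
      if e.symm (f.eval (e i)) = j then Polynomial.X else 0
    else Polynomial.C (MvPolynomial.X (i, j))
  | Sum.inr t => if t = t₀ then 1 else 0

theorem coeffDegreeLE_nwSubst (F : Type*) [Field F] (e : Fin n ≃ K) (t₀ : Fin n) (k : ℕ)
    (f : Polynomial K) (v : NWVar n) : CoeffDegreeLE (nwSubst F e t₀ k f v) 1 := by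
  intro c
  rcases v with ⟨i, j⟩ | t
  · simp only [nwSubst]
    split_ifs
    · rw [Polynomial.coeff_X]; split_ifs <;> simp
    · simp
    · rw [Polynomial.coeff_C]; split_ifs <;> simp
  · simp only [nwSubst]
    split_ifs
    · rw [Polynomial.coeff_one]; split_ifs <;> simp
    · simp

theorem nwSubst_coeff_zero (F : Type*) [Field F] (e : Fin n ≃ K) (t₀ : Fin n) (k : ℕ)
    (f h : Polynomial K) (v : NWVar n) :
    (nwSubst F e t₀ k f v).coeff 0 = (nwSubst F e t₀ k h v).coeff 0 := by
  rcases v with ⟨i, j⟩ | t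
  · simp only [nwSubst]
    split_ifs <;> simp
  · rfl

/-- The exponent of the monomial `∏ i ≥ k, x_{i, f(i)}`. -/
noncomputable def tailExp (e : Fin n ≃ K) (k : ℕ) (f : Polynomial K) : Fin n × Fin n →₀ ℕ :=
  ∑ i ∈ univ.filter fun i : Fin n => ¬ (i : ℕ) < k, Finsupp.single (i, e.symm (f.eval (e i))) 1

theorem tailExp_apply (e : Fin n ≃ K) (k : ℕ) (f : Polynomial K) (i j : Fin n) :
    tailExp e k f (i, j) = if ¬ (i : ℕ) < k ∧ e.symm (f.eval (e i)) = j then 1 else 0 := by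
  classical
  simp only [tailExp, Finsupp.finsetSum_apply, sum_filter]
  rw [sum_eq_single i]
  · by_cases h : (i : ℕ) < k <;> simp [h, Finsupp.single_apply]
  · intro b _ hb
    split_ifs <;> simp [hb]
  · simp

theorem card_filter_val_lt {k : ℕ} (hk : k ≤ n) : #{i : Fin n | (i : ℕ) < k} = k := by
  rw [Fin.card_filter_val_lt, min_eq_right hk]

/-- Of the `n` blocks, `k` are removed from the tail and fewer than `k` are places where `f` and `h`
agree. Every other block contributes its own variable to the difference. -/
theorem sub_two_mul_le_degree_tailExp_sub (e : Fin n ≃ K) {k : ℕ} (hk : k ≤ n)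
    {f h : Polynomial K} (hf : f.degree < k) (hh : h.degree < k) (hne : f ≠ h) :
    n - 2 * k ≤ (tailExp e k h - tailExp e k f).degree := by
  classical
  have hagree : #{i : Fin n | f.eval (e i) = h.eval (e i)} < k := by
    by_contra! hle
    exact hne (eq_of_eval_eq_of_degree_lt e _ hf hh hle fun i hi => (mem_filter.1 hi).2)
  set S : Finset (Fin n) := {i : Fin n | ¬ (i : ℕ) < k ∧ f.eval (e i) ≠ h.eval (e i)} with hS
  have hcov : (univ : Finset (Fin n)) ⊆ S ∪ (({i : Fin n | (i : ℕ) < k} : Finset (Fin n)) ∪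
      ({i : Fin n | f.eval (e i) = h.eval (e i)} : Finset (Fin n))) := by
    intro i _
    simp only [hS, mem_union, mem_filter, mem_univ, true_and]
    tauto
  have h1 := (card_le_card hcov).trans ((card_union_le _ _).trans
    (add_le_add_right (card_union_le _ _) _))
  rw [card_univ, Fintype.card_fin, card_filter_val_lt hk] at h1
  refine (show n - 2 * k ≤ #S by omega).trans ?_
  rw [Finsupp.degree_eq_sum, card_eq_sum_ones]
  have hinj : Set.InjOn (fun i => (i, e.symm (h.eval (e i)))) (S : Set (Fin n)) :=
    fun a _ b _ hab => (Prod.mk.inj hab).1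
  refine le_trans ?_ (sum_le_sum_of_subset (subset_univ
    (S.image fun i => (i, e.symm (h.eval (e i))))))
  rw [sum_image hinj]
  refine sum_le_sum fun i hi => ?_
  obtain ⟨hik, hfh⟩ := (mem_filter.1 hi).2
  rw [Finsupp.tsub_apply, tailExp_apply, tailExp_apply, if_pos ⟨hik, rfl⟩, if_neg]
  rintro ⟨-, h2⟩
  exact hfh (e.symm.injective h2)

variable [Fintype K]

/-- The values at the first `k` points determine a polynomial of degree below `k`. So every `h ≠ f`
has a variable in the first `k` blocks that is sent to `0`, and `f` itself gives `X ^ k` times its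
tail. -/
theorem coeff_aeval_nwSubst_sum (F : Type*) [Field F] (e : Fin n ≃ K) (t₀ : Fin n) {k : ℕ}
    (hkn : k ≤ n) (f : Polynomial.degreeLT K k) :
    (MvPolynomial.aeval (nwSubst F e t₀ k f) (∑ h : Polynomial.degreeLT K k,
      ∏ i : Fin n, (MvPolynomial.X (Sum.inl (i, e.symm ((h : Polynomial K).eval (e i)))) :
        MvPolynomial (NWVar n) F))).coeff k =
      MvPolynomial.monomial (tailExp e k f) (1 : F) := by
  classical
  rw [map_sum, sum_eq_single f]
  · rw [map_prod, ← prod_filter_mul_prod_filter_not univ fun i : Fin n => (i : ℕ) < k]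
    have e1 : ∏ i ∈ univ.filter fun i : Fin n => (i : ℕ) < k, MvPolynomial.aeval (nwSubst F e t₀ k f)
        (MvPolynomial.X (Sum.inl (i, e.symm ((f : Polynomial K).eval (e i)))) :
          MvPolynomial (NWVar n) F) = Polynomial.X ^ k := by
      refine (prod_eq_pow_card (b := Polynomial.X) fun i hi => ?_).trans
        (by rw [card_filter_val_lt hkn])
      rw [MvPolynomial.aeval_X]
      simp [nwSubst, (mem_filter.1 hi).2]
    have e2 : ∏ i ∈ univ.filter fun i : Fin n => ¬ (i : ℕ) < k, MvPolynomial.aeval (nwSubst F e t₀ k f)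
        (MvPolynomial.X (Sum.inl (i, e.symm ((f : Polynomial K).eval (e i)))) :
          MvPolynomial (NWVar n) F) =
        Polynomial.C (MvPolynomial.monomial (tailExp e k f) 1) := by
      rw [tailExp, MvPolynomial.monomial_sum_one, map_prod]
      refine prod_congr rfl fun i hi => ?_
      rw [MvPolynomial.aeval_X]
      simp only [nwSubst, (mem_filter.1 hi).2, if_false]
      rfl
    rw [e1, e2, Polynomial.coeff_mul_C, Polynomial.coeff_X_pow_self, one_mul]
  · intro h _ hne
    have hex : ∃ i : Fin n, (i : ℕ) < k ∧
        (h : Polynomial K).eval (e i) ≠ (f : Polynomial K).eval (e i) := by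
      by_contra! hall
      refine hne (Subtype.ext (eq_of_eval_eq_of_degree_lt e {i : Fin n | (i : ℕ) < k}
        (Polynomial.mem_degreeLT.1 h.2) (Polynomial.mem_degreeLT.1 f.2) ?_ fun i hi => ?_))
      · rw [card_filter_val_lt hkn]
      · exact hall i (mem_filter.1 hi).2
    obtain ⟨i, hik, hi⟩ := hex
    rw [map_prod]
    refine prod_eq_zero (mem_univ i) ?_
    rw [MvPolynomial.aeval_X]
    simp [nwSubst, hik, hi.symm]
  · simp

theorem coeff_aeval_nwSubst (F : Type*) [Field F] (e : Fin n ≃ K) (t₀ : Fin n)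
    (f : Polynomial.degreeLT K (n / (2 * ((t₀ : ℕ) + 1)))) :
    (MvPolynomial.aeval (nwSubst F e t₀ (n / (2 * ((t₀ : ℕ) + 1))) f) (NW F e)).coeff
      (n / (2 * ((t₀ : ℕ) + 1))) =
      MvPolynomial.monomial (tailExp e (n / (2 * ((t₀ : ℕ) + 1))) f) 1 := by
  rw [NW, map_sum, sum_eq_single t₀]
  · rw [map_mul, MvPolynomial.aeval_X]
    simp only [nwSubst, if_true, one_mul]
    exact coeff_aeval_nwSubst_sum F e t₀ (Nat.div_le_self _ _) f
  · intro t _ ht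
    rw [map_mul, MvPolynomial.aeval_X]
    simp [nwSubst, ht]
  · simp

theorem card_le_card_of_monomial_mem_span {F σ : Type*} [Field F] (U : Finset (σ →₀ ℕ))
    (G : Finset (MvPolynomial σ F))
    (h : ∀ m ∈ U, MvPolynomial.monomial m (1 : F) ∈ Submodule.span F (G : Set (MvPolynomial σ F))) :
    #U ≤ #G := by
  classical
  have hli : LinearIndependent F fun m : U => MvPolynomial.monomial (m : σ →₀ ℕ) (1 : F) := by
    have := (MvPolynomial.basisMonomials σ F).linearIndependent.comp (fun m : U => (m : σ →₀ ℕ))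
      Subtype.val_injective
    rwa [MvPolynomial.coe_basisMonomials] at this
  have hle := linearIndependent_le_span' _ hli (G : Set (MvPolynomial σ F)) (by
    rintro _ ⟨m, rfl⟩
    exact h m m.2)
  simpa using hle

/-- Two estimates of the dimension spanned by the shifted tails: the Bonferroni count of distinct
monomials, which are linearly independent, and the number of generators available to a uniform sum.
-/
theorem IsUniformSum.nw_shifted_bound {F : Type*} [Field F] (e : Fin n ≃ K) {D : Multiset ℕ}
    {s : ℕ} (hD : IsUniformSum D s (NW F e)) (t₀ : Fin n) (T l : ℕ) (hT : 0 < T) {k : ℕ}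
    (hk : k = n / (2 * ((t₀ : ℕ) + 1))) :
    n ^ k * (n * n + l).choose l ≤
      s * (2 ^ ((D.filter (· ≤ T)).sum / T + 1) *
        (n * n + (l + (D.filter (¬ · ≤ T)).sum + k * (2 * T))).choose
          (l + (D.filter (¬ · ≤ T)).sum + k * (2 * T))) +
      (n ^ k) ^ 2 * (n * n + (l - (n - 2 * k))).choose (l - (n - 2 * k)) := by
  classical
  subst hk
  set k := n / (2 * ((t₀ : ℕ) + 1)) with hk
  have hkn : k ≤ n := Nat.div_le_self _ _
  obtain ⟨G, hG, hspan⟩ := hD.exists_spanning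
    (fun f : Polynomial.degreeLT K k => nwSubst F e t₀ k f)
    (fun f => coeffDegreeLE_nwSubst F e t₀ k f)
    (fun f h => nwSubst_coeff_zero F e t₀ k f h) T k l hT
  have hcard : Fintype.card (Fin n × Fin n) = n * n := by simp
  have hunion := card_union_add_ge (univ : Finset (Polynomial.degreeLT K k))
    (fun f => (expLE (Fin n × Fin n) l).image (tailExp e k f + ·))
    ((n * n + l).choose l) ((n * n + (l - (n - 2 * k))).choose (l - (n - 2 * k)))
    (fun f _ => by
      rw [card_image_of_injective _ (add_right_injective _), card_expLE, hcard])
    (fun f _ h _ hne => by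
      refine (card_inter_shift_le _ _ l (n - 2 * k) ?_).trans (by rw [card_expLE, hcard])
      exact sub_two_mul_le_degree_tailExp_sub e hkn (Polynomial.mem_degreeLT.1 f.2)
        (Polynomial.mem_degreeLT.1 h.2) fun hfh => hne (Subtype.ext hfh))
  rw [card_univ, card_degreeLT e] at hunion
  refine hunion.trans (Nat.add_le_add_right ?_ _)
  rw [card_expLE, hcard] at hG
  refine le_trans ?_ hG
  refine card_le_card_of_monomial_mem_span _ G fun m hm => ?_
  obtain ⟨f, -, hf⟩ := mem_biUnion.1 hm
  obtain ⟨β, hβ, rfl⟩ := mem_image.1 hf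
  have := hspan f (MvPolynomial.monomial β 1) (by
    rw [MvPolynomial.totalDegree_monomial _ one_ne_zero]
    exact mem_expLE.1 hβ)
  rwa [coeff_aeval_nwSubst, MvPolynomial.monomial_mul, one_mul, add_comm] at this

end NWShifted

/-! ### Choice of the shift and numerical estimates -/

section Numerics

theorem half_sqrt_le_natSqrt {n : ℕ} (hn : 4 ≤ n) : Real.sqrt n / 2 ≤ (Nat.sqrt n : ℝ) := by
  have h1 : Real.sqrt n ≤ Nat.sqrt n + 1 := Real.real_sqrt_le_nat_sqrt_succ
  have h2 : 1 ≤ Nat.sqrt n := by rw [Nat.le_sqrt]; omega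
  have h3 : (1 : ℝ) ≤ Nat.sqrt n := by exact_mod_cast h2
  linarith

/-- The bound that comes from counting monomials. -/
theorem exp_sqrt_le_of_card_bound {n s W b : ℕ} (hlog : 50 < Real.log n) (hn : 100 ≤ n)
    (hW : 10 * W ≤ n) (hb : Nat.sqrt n * b ≤ n + 1)
    (h : n ^ (n / 2) ≤ s * ((n ^ 2 + n + 1) ^ W * s ^ b)) :
    Real.exp (Real.sqrt n) ≤ s := by
  have hnpos : 0 < n := by omega
  have hs : 0 < s := by
    rcases Nat.eq_zero_or_pos s with rfl | h0
    · have := Nat.pow_pos (n := n / 2) hnpos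
      omega
    · exact h0
  have hn' : (100 : ℝ) ≤ n := by exact_mod_cast hn
  have hsR : (0 : ℝ) < s := by exact_mod_cast hs
  rw [← Real.le_log_iff_exp_le hsR]
  -- If `log s < √n`, then `b ≤ 4√n` and `W ≤ n / 10` turn the logarithm of the bound into `(n / 5 -
  -- 1 / 2) log n ≤ 4n + √n`, which is false for `log n > 50`.
  by_contra! hlt
  have hS0 : (0 : ℝ) ≤ Real.log s := Real.log_natCast_nonneg s
  have h1 : (n : ℝ) ^ (n / 2) ≤ s * ((n ^ 2 + n + 1) ^ W * s ^ b) := by exact_mod_cast h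
  have h2 := Real.log_le_log (by positivity) h1
  rw [Real.log_mul (by positivity) (by positivity), Real.log_mul (by positivity) (by positivity),
    Real.log_pow, Real.log_pow, Real.log_pow] at h2
  have h3 : Real.log ((n : ℝ) ^ 2 + n + 1) ≤ 3 * Real.log n := by
    have : (3 : ℝ) * Real.log n = Real.log ((n : ℝ) ^ 3) := by rw [Real.log_pow]; norm_num
    rw [this]
    exact Real.log_le_log (by positivity) (by nlinarith)
  have hhalf : ((n : ℝ) - 1) / 2 ≤ ((n / 2 : ℕ) : ℝ) := by
    have : n ≤ 2 * (n / 2) + 1 := by omega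
    have : (n : ℝ) ≤ 2 * ((n / 2 : ℕ) : ℝ) + 1 := by exact_mod_cast this
    linarith
  have hsq : Real.sqrt n * Real.sqrt n = n := Real.mul_self_sqrt (by positivity)
  have hsq10 : 10 ≤ Real.sqrt n := Real.le_sqrt_of_sq_le (by linarith)
  have hT := half_sqrt_le_natSqrt (show 4 ≤ n by omega)
  have hbR : (Nat.sqrt n : ℝ) * b ≤ n + 1 := by exact_mod_cast hb
  have hb4 : (b : ℝ) ≤ 4 * Real.sqrt n := by
    have h5 : Real.sqrt n / 2 * b ≤ n + 1 :=
      (mul_le_mul_of_nonneg_right hT (Nat.cast_nonneg b)).trans hbR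
    by_contra! hcon
    nlinarith
  have hW' : (10 : ℝ) * W ≤ n := by exact_mod_cast hW
  have hA : (W : ℝ) * Real.log ((n : ℝ) ^ 2 + n + 1) ≤ n / 10 * (3 * Real.log n) :=
    mul_le_mul (by linarith) h3 (Real.log_nonneg (by nlinarith)) (by positivity)
  have hB : (b : ℝ) * Real.log s ≤ 4 * Real.sqrt n * Real.sqrt n :=
    mul_le_mul hb4 hlt.le hS0 (by positivity)
  have hC : ((n : ℝ) - 1) / 2 * Real.log n ≤ ((n / 2 : ℕ) : ℝ) * Real.log n :=
    mul_le_mul_of_nonneg_right hhalf (by linarith)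
  have hD : Real.sqrt n ≤ n := by nlinarith
  have hE : (n : ℝ) * 50 ≤ n * Real.log n := mul_le_mul_of_nonneg_left hlog.le (by positivity)
  nlinarith

/-- Replacing `l + 1` by `l` costs at most a factor `1 + 1 / l`. So the largest admissible shift
almost attains equality; this is the source of the term `d / l` in `exists_shift`. -/
theorem one_add_div_le {N l : ℝ} (hl : 0 < l) :
    1 + N / l ≤ (1 + 1 / l) * (1 + N / (l + 1)) := by
  have : (1 + 1 / l) * (1 + N / (l + 1)) = 1 + N / l + 1 / l := by
    field_simp
    ring
  rw [this]
  have : 0 < 1 / l := by positivity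
  linarith

/-- The shift is chosen as large as possible with `2 * a ≤ (1 + N / l) ^ d`. -/
theorem exists_shift (N n d : ℕ) (a : ℝ) (ha : 1 ≤ a) (hn : 0 < n)
    (h : 2 * a ≤ (1 + N / n : ℝ) ^ d) :
    ∃ l : ℕ, n ≤ l ∧ 2 * a ≤ (1 + N / l : ℝ) ^ d ∧
      d * Real.log (1 + N / l) ≤ d / l + Real.log (2 * a) := by
  classical
  have hex : ∃ j : ℕ, (1 + N / (n + j : ℕ) : ℝ) ^ d < 2 * a := by
    -- This makes `N * d / (n + j) ≤ 1 / 2`, so the power is at most `exp (1 / 2) < 2 ≤ 2 * a`.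
    refine ⟨2 * (N * d), ?_⟩
    have hx : (N : ℝ) / (n + 2 * (N * d) : ℕ) * d ≤ 1 / 2 := by
      rw [div_mul_eq_mul_div, div_le_div_iff₀ (by positivity) (by norm_num)]
      push_cast
      have : (0 : ℝ) < n := by exact_mod_cast hn
      linarith
    have h1 : (1 + (N : ℝ) / (n + 2 * (N * d) : ℕ)) ^ d ≤ Real.exp (1 / 2) := by
      refine le_trans ?_ (Real.exp_le_exp.2 hx)
      rw [mul_comm _ (d : ℝ), Real.exp_nat_mul]
      refine pow_le_pow_left₀ (by positivity) ?_ d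
      rw [add_comm]
      exact Real.add_one_le_exp _
    have h2 : Real.exp (1 / 2) < 2 := by
      have h3 : Real.exp (1 / 2) * Real.exp (1 / 2) = Real.exp 1 := by
        rw [← Real.exp_add]; norm_num
      have := Real.exp_one_lt_d9
      nlinarith [Real.exp_pos (1 / 2)]
    linarith
  set j := Nat.find hex with hj
  have hspec := Nat.find_spec hex
  rw [← hj] at hspec
  obtain ⟨i, hi⟩ : ∃ i, j = i + 1 := by
    refine Nat.exists_eq_succ_of_ne_zero fun h0 => ?_
    rw [h0, add_zero] at hspec
    linarith
  have hmin := Nat.find_min hex (m := i) (by omega)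
  push Not at hmin
  refine ⟨n + i, by omega, hmin, ?_⟩
  rw [hi] at hspec
  have hlpos : (0 : ℝ) < (n + i : ℕ) := by exact_mod_cast (by omega : 0 < n + i)
  have hlog := Real.log_le_log (by positivity) (one_add_div_le (N := N) hlpos)
  rw [Real.log_mul (by positivity) (by positivity)] at hlog
  have h1 : Real.log (1 + 1 / (n + i : ℕ)) ≤ 1 / (n + i : ℕ) := by
    have := Real.log_le_sub_one_of_pos (show (0 : ℝ) < 1 + 1 / (n + i : ℕ) by positivity)
    linarith
  have h2 : d * Real.log (1 + N / ((n + i : ℕ) + 1)) ≤ Real.log (2 * a) := by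
    rw [← Real.log_pow]
    refine Real.log_le_log (by positivity) ?_
    have e1 : ((n + (i + 1) : ℕ) : ℝ) = (n + i : ℕ) + 1 := by push_cast; ring
    rw [e1] at hspec
    exact hspec.le
  have hd : (0 : ℝ) ≤ d := Nat.cast_nonneg d
  calc (d : ℝ) * Real.log (1 + N / (n + i : ℕ))
      ≤ d * (1 / (n + i : ℕ) + Real.log (1 + N / ((n + i : ℕ) + 1))) :=
        mul_le_mul_of_nonneg_left (by linarith) hd
    _ = d / (n + i : ℕ) + d * Real.log (1 + N / ((n + i : ℕ) + 1)) := by ring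
    _ ≤ _ := by linarith

theorem add_one_le_five_mul {x r N : ℝ} (hr : r * r = N) (h100 : 100 ≤ r)
    (h : x * (r / 2) ≤ N + 1) : x + 1 ≤ 5 * r := by
  by_contra! hcon
  nlinarith

theorem div_le_of_lt_add_one_mul {x r T N : ℝ} (hr : r * r = N) (h100 : 100 ≤ r) (hT : T ≤ r)
    (hx : 0 ≤ x) (h : N < (x + 1) * (2 * (20 * T))) : r / 80 ≤ x := by
  by_contra! hcon
  have h1 : (x + 1) * (2 * (20 * T)) ≤ (x + 1) * (2 * (20 * r)) :=
    mul_le_mul_of_nonneg_left (by linarith) (by linarith)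
  nlinarith

/-- The bound that comes from shifted coefficients. -/
theorem exp_sqrt_le_of_shifted_bound {n s W B k : ℕ} (hlog : 20000 ≤ Real.log n)
    (hn : 20000 ≤ n) (hWB : W + B = n + 1) (hW : n ≤ 10 * W)
    (hk : k = n / (2 * (20 * Nat.sqrt n)))
    (h : ∀ l : ℕ, n ^ k * (n * n + l).choose l ≤
      s * (2 ^ (W / Nat.sqrt n + 1) *
        (n * n + (l + B + k * (2 * Nat.sqrt n))).choose (l + B + k * (2 * Nat.sqrt n))) +
      (n ^ k) ^ 2 * (n * n + (l - (n - 2 * k))).choose (l - (n - 2 * k))) :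
    Real.exp (Real.sqrt n) ≤ s := by
  set T := Nat.sqrt n with hT
  have hT100 : 100 ≤ T := by rw [hT, Nat.le_sqrt]; omega
  have hTT : T * T ≤ n := Nat.sqrt_le n
  have hkT : k * (2 * (20 * T)) ≤ n := by rw [hk]; exact Nat.div_mul_le_self _ _
  have hkT' : n < (k + 1) * (2 * (20 * T)) := by
    rw [hk]
    exact (Nat.div_lt_iff_lt_mul (by omega)).1 (Nat.lt_succ_self _)
  have hk4000 : 4000 * k ≤ n := by nlinarith
  set d := n - 2 * k with hd
  set e := B + k * (2 * T) with he
  have heB : 20 * e ≤ 19 * n + 20 := by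
    have : 20 * (k * (2 * T)) ≤ n := by nlinarith
    omega
  have hed : 100 * e ≤ 97 * d := by omega
  have hdn : d ≤ n := by omega
  have hnpos : 0 < n := by omega
  have hn' : (20000 : ℝ) ≤ n := by exact_mod_cast hn
  have ha : (1 : ℝ) ≤ (n : ℝ) ^ k := one_le_pow₀ (by linarith)
  obtain ⟨l, hnl, hl1, hl2⟩ := exists_shift (n * n) n d ((n : ℝ) ^ k) ha hnpos (by
    have e1 : (1 + ((n * n : ℕ) : ℝ) / n) = 1 + n := by
      push_cast; field_simp
    rw [e1]
    calc 2 * (n : ℝ) ^ k ≤ n * (n : ℝ) ^ k := by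
          refine mul_le_mul_of_nonneg_right (by linarith) (by positivity)
      _ = (n : ℝ) ^ (k + 1) := by ring
      _ ≤ (n : ℝ) ^ d := pow_le_pow_right₀ (by linarith) (by omega)
      _ ≤ (1 + n : ℝ) ^ d := pow_le_pow_left₀ (by positivity) (by linarith) d)
  set g : ℝ := 1 + ((n * n : ℕ) : ℝ) / l with hg
  have hgpos : 0 < g := by positivity
  have hlpos : 0 < l := by omega
  have hlR : (0 : ℝ) < l := by exact_mod_cast hlpos
  obtain ⟨c, hc⟩ : ∃ c : ℝ, ((n * n + l).choose l : ℝ) = c := ⟨_, rfl⟩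
  have hcpos : 0 < c := by
    rw [← hc]
    exact_mod_cast Nat.choose_pos (by omega)
  have hup := choose_add_le_pow_mul (n * n) l e hlpos
  have hlow := pow_mul_choose_le (n * n) (l - d) d (by omega)
  have hld : l - d + d = l := by omega
  rw [hld, hc] at hlow
  rw [hc] at hup
  have hmain : (n : ℝ) ^ k * c ≤ s * (2 ^ (W / T + 1) *
      ((n * n + (l + e)).choose (l + e) : ℝ)) +
      ((n : ℝ) ^ k) ^ 2 * ((n * n + (l - d)).choose (l - d) : ℝ) := by
    have := h l
    rw [add_assoc l B, ← he] at this
    rw [← hc]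
    exact_mod_cast this
  -- The shift satisfies `2 * n ^ k ≤ g ^ d`, so the overlaps cost at most half of the main term.
  have hs2 : ((n : ℝ) ^ k) ^ 2 * ((n * n + (l - d)).choose (l - d) : ℝ) ≤ (n : ℝ) ^ k * c / 2 := by
    have h1 : 2 * (n : ℝ) ^ k * ((n * n + (l - d)).choose (l - d) : ℝ) ≤ c :=
      (mul_le_mul_of_nonneg_right hl1 (by positivity)).trans hlow
    nlinarith
  have hs3 : s * (2 ^ (W / T + 1) * ((n * n + (l + e)).choose (l + e) : ℝ)) ≤
      s * (2 ^ (W / T + 1) * (g ^ e * c)) := by gcongr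
  have hs4 : (n : ℝ) ^ k ≤ 2 * s * 2 ^ (W / T + 1) * g ^ e := by
    refine le_of_mul_le_mul_right ?_ hcpos
    calc (n : ℝ) ^ k * c ≤ 2 * (s * (2 ^ (W / T + 1) * (g ^ e * c))) := by linarith
      _ = _ := by ring
  have hsR : (0 : ℝ) < s := by
    rcases Nat.eq_zero_or_pos s with rfl | h0
    · simp only [Nat.cast_zero, mul_zero, zero_mul] at hs4
      linarith
    · exact_mod_cast h0
  have hs5 := Real.log_le_log (by positivity) hs4
  rw [Real.log_mul (by positivity) (by positivity), Real.log_mul (by positivity) (by positivity),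
    Real.log_mul (by positivity) (by positivity), Real.log_pow, Real.log_pow, Real.log_pow] at hs5
  rw [Real.log_mul (by positivity) (by positivity), Real.log_pow] at hl2
  have hlog2 : Real.log 2 ≤ 1 := by
    have := Real.log_two_lt_d9
    linarith
  have hlog2' : 0 ≤ Real.log 2 := Real.log_nonneg (by norm_num)
  have hlogg : 0 ≤ Real.log g := Real.log_nonneg (by rw [hg]; simp; positivity)
  have hdl : (d : ℝ) / l ≤ 1 := by
    rw [div_le_one hlR]
    exact_mod_cast hdn.trans hnl
  -- By maximality of `l`, `d * log g` is at most `k * log n` plus a constant. Hence `g ^ e`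
  -- consumes only about 97% of `n ^ k`.
  have heg : (e : ℝ) * Real.log g ≤ 97 / 100 * (d * Real.log g) := by
    have : (100 : ℝ) * e ≤ 97 * d := by exact_mod_cast hed
    nlinarith
  have hsq : Real.sqrt n * Real.sqrt n = n := Real.mul_self_sqrt (by positivity)
  have hsq100 : 100 ≤ Real.sqrt n := Real.le_sqrt_of_sq_le (by linarith)
  have hT2 : Real.sqrt n / 2 ≤ T := half_sqrt_le_natSqrt (by omega)
  have hTsq : (T : ℝ) ≤ Real.sqrt n := Real.nat_sqrt_le_real_sqrt
  have hTpos : (0 : ℝ) < T := by exact_mod_cast (by omega : 0 < T)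
  have hm : ((W / T + 1 : ℕ) : ℝ) ≤ 5 * Real.sqrt n := by
    have h1 : ((W / T : ℕ) : ℝ) * T ≤ n + 1 := by
      have : W / T * T ≤ n + 1 := (Nat.div_mul_le_self _ _).trans (by omega)
      exact_mod_cast this
    have h2 : ((W / T : ℕ) : ℝ) * (Real.sqrt n / 2) ≤ n + 1 :=
      (mul_le_mul_of_nonneg_left hT2 (Nat.cast_nonneg _)).trans h1
    push_cast
    exact add_one_le_five_mul hsq hsq100 h2
  have hkge : Real.sqrt n / 80 ≤ k := by
    have h1 : (n : ℝ) < (k + 1) * (2 * (20 * T)) := by exact_mod_cast hkT'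
    exact div_le_of_lt_add_one_mul hsq hsq100 hTsq (Nat.cast_nonneg k) h1
  -- The remaining 3% of `k log n ≥ 250 √n` is at least `7.5 √n`; the groups take at most `5 √n`,
  -- and what is left exceeds `√n` plus the constants.
  have hkL : Real.sqrt n / 80 * 20000 ≤ k * Real.log n :=
    mul_le_mul hkge hlog (by norm_num) (by positivity)
  have hmL : ((W / T + 1 : ℕ) : ℝ) * Real.log 2 ≤ 5 * Real.sqrt n * 1 :=
    mul_le_mul hm hlog2 hlog2' (by positivity)
  rw [← Real.le_log_iff_exp_le hsR]
  linarith

end Numerics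

/-! ### Building circuits layer by layer -/

section CircuitConstruction

variable {F σ : Type*} [CommSemiring F]

/-- Some circuit with at most `s` nodes and at most `w` wires computes all polynomials in `A`. -/
def HasCircuit (A : Set (MvPolynomial σ F)) (s w : ℕ) : Prop :=
  ∃ C : ArithCircuit F σ, C.size ≤ s ∧ C.wires ≤ w ∧ ∀ p ∈ A, ∃ v, C.value v = p

theorem HasCircuit.mono {A B : Set (MvPolynomial σ F)} {s w : ℕ} (h : HasCircuit A s w)
    (hB : B ⊆ A) : HasCircuit B s w := by
  obtain ⟨C, h1, h2, h3⟩ := h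
  exact ⟨C, h1, h2, fun p hp => h3 p (hB hp)⟩

/-- The circuit with output `v` in place of the given one. -/
def ArithCircuit.withOutput (C : ArithCircuit F σ) (v : C.Node) : ArithCircuit F σ :=
  { C with output := v }

theorem HasCircuit.exists_poly_eq {A : Set (MvPolynomial σ F)} {s w : ℕ} (h : HasCircuit A s w)
    {p : MvPolynomial σ F} (hp : p ∈ A) :
    ∃ C : ArithCircuit F σ, C.size ≤ s ∧ C.wires ≤ w ∧ C.poly = p := by
  obtain ⟨C, h1, h2, h3⟩ := h
  obtain ⟨v, hv⟩ := h3 p hp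
  exact ⟨C.withOutput v, h1, h2, hv⟩

theorem hasCircuit_leaves {ι : Type} [Fintype ι] [Nonempty ι] (label : ι → F ⊕ σ) :
    HasCircuit (Set.range fun i => Sum.elim MvPolynomial.C MvPolynomial.X (label i))
      (Fintype.card ι) 0 := by
  classical
  let gate : ι → Gate F σ ι := fun i => Sum.elim Gate.const Gate.var (label i)
  have hin : ∀ i, (gate i).inputs = 0 := by
    intro i
    simp only [gate]
    rcases label i with c | x <;> rfl
  let C : ArithCircuit F σ :=
    { Node := ι
      gate := gate
      acyclic := ⟨fun a => ⟨a, fun b hb => by rw [hin] at hb; simp at hb⟩⟩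
      output := Classical.arbitrary ι }
  refine ⟨C, le_rfl, ?_, ?_⟩
  · refine (sum_eq_zero fun v _ => ?_).le
    exact Multiset.card_eq_zero.2 (hin v)
  · rintro _ ⟨i, rfl⟩
    refine ⟨i, ?_⟩
    dsimp only
    rcases h : label i with c | x
    · exact C.value_of_const (show gate i = _ by simp only [gate, h]; rfl)
    · exact C.value_of_var (show gate i = _ by simp only [gate, h]; rfl)

/-- The gate with its inputs renamed. -/
def Gate.mapInputs {ν μ : Type*} (f : ν → μ) : Gate F σ ν → Gate F σ μ
  | .const c => .const c
  | .var x => .var x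
  | .add s => .add (s.map f)
  | .mul s => .mul (s.map f)

omit [CommSemiring F] in
theorem Gate.inputs_mapInputs {ν μ : Type*} (f : ν → μ) (g : Gate F σ ν) :
    (g.mapInputs f).inputs = g.inputs.map f := by
  cases g <;> simp [mapInputs, inputs]

/-- The circuit with further gates on top. -/
noncomputable def ArithCircuit.extend (C : ArithCircuit F σ) {κ : Type} [Fintype κ]
    (g : κ → Gate F σ C.Node) : ArithCircuit F σ where
  Node := C.Node ⊕ κ
  gate := Sum.elim (fun v => (C.gate v).mapInputs Sum.inl) fun k => (g k).mapInputs Sum.inl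
  acyclic := by
    have hl : ∀ v : C.Node, Acc (fun w v : C.Node ⊕ κ => w ∈ ((Sum.elim
        (fun v => (C.gate v).mapInputs Sum.inl) fun k => (g k).mapInputs Sum.inl :
          C.Node ⊕ κ → Gate F σ (C.Node ⊕ κ)) v).inputs) (Sum.inl v) := by
      intro v
      induction v using C.acyclic.induction with
      | _ v ih =>
        refine ⟨_, fun w hw => ?_⟩
        rw [Sum.elim_inl, Gate.inputs_mapInputs] at hw
        obtain ⟨u, hu, rfl⟩ := Multiset.mem_map.1 hw
        exact ih u hu
    refine ⟨fun v => ?_⟩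
    rcases v with v | k
    · exact hl v
    · refine ⟨_, fun w hw => ?_⟩
      rw [Sum.elim_inr, Gate.inputs_mapInputs] at hw
      obtain ⟨u, -, rfl⟩ := Multiset.mem_map.1 hw
      exact hl u
  output := Sum.inl C.output

omit [CommSemiring F] in
theorem ArithCircuit.extend_size (C : ArithCircuit F σ) {κ : Type} [Fintype κ]
    (g : κ → Gate F σ C.Node) : (C.extend g).size = C.size + Fintype.card κ :=
  Fintype.card_sum

omit [CommSemiring F] in
theorem ArithCircuit.extend_wires (C : ArithCircuit F σ) {κ : Type} [Fintype κ]
    (g : κ → Gate F σ C.Node) :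
    (C.extend g).wires = C.wires + ∑ k, (g k).inputs.card := by
  refine (Fintype.sum_sum_type _).trans ?_
  congr 1
  · refine sum_congr rfl fun v _ => ?_
    exact (congrArg Multiset.card (Gate.inputs_mapInputs Sum.inl (C.gate v))).trans
      (Multiset.card_map _ _)
  · refine sum_congr rfl fun k _ => ?_
    exact (congrArg Multiset.card (Gate.inputs_mapInputs Sum.inl (g k))).trans
      (Multiset.card_map _ _)

/-- The nodes of a circuit as nodes of an extension. -/
def ArithCircuit.extendInl (C : ArithCircuit F σ) {κ : Type} [Fintype κ]
    (g : κ → Gate F σ C.Node) : C.Node → (C.extend g).Node := Sum.inl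

theorem ArithCircuit.extend_value_inl (C : ArithCircuit F σ) {κ : Type} [Fintype κ]
    (g : κ → Gate F σ C.Node) (v : C.Node) :
    (C.extend g).value (C.extendInl g v) = C.value v := by
  induction v using C.acyclic.induction with
  | _ v ih =>
    have hg : (C.extend g).gate (C.extendInl g v) = (C.gate v).mapInputs (C.extendInl g) := rfl
    rcases h : C.gate v with c | x | s | s <;> rw [h] at hg ih
    · rw [C.value_of_const h, (C.extend g).value_of_const hg]
    · rw [C.value_of_var h, (C.extend g).value_of_var hg]
    · rw [C.value_of_add h, (C.extend g).value_of_add hg, Multiset.map_map]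
      exact congrArg Multiset.sum (Multiset.map_congr rfl fun w hw => ih w hw)
    · rw [C.value_of_mul h, (C.extend g).value_of_mul hg, Multiset.map_map]
      exact congrArg Multiset.prod (Multiset.map_congr rfl fun w hw => ih w hw)

/-- A layer of sum and product gates of fan-in at most `d`. -/
theorem HasCircuit.layer {A : Set (MvPolynomial σ F)} {s w : ℕ} (h : HasCircuit A s w)
    {κ : Type} [Fintype κ] (q : κ → MvPolynomial σ F) (d : ℕ)
    (hq : ∀ k, ∃ S : Multiset (MvPolynomial σ F), (∀ p ∈ S, p ∈ A) ∧ S.card ≤ d ∧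
      (q k = S.sum ∨ q k = S.prod)) :
    HasCircuit (A ∪ Set.range q) (s + Fintype.card κ) (w + Fintype.card κ * d) := by
  classical
  obtain ⟨C, h1, h2, h3⟩ := h
  choose S hS1 hS2 hS3 using hq
  have hout : ∃ out : MvPolynomial σ F → C.Node, ∀ p ∈ A, C.value (out p) = p := by
    refine ⟨fun p => if hp : p ∈ A then (h3 p hp).choose else C.output, fun p hp => ?_⟩
    dsimp only
    rw [dif_pos hp]
    exact (h3 p hp).choose_spec
  obtain ⟨out, hout⟩ := hout
  let g : κ → Gate F σ C.Node := fun k =>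
    if q k = (S k).sum then .add ((S k).map out) else .mul ((S k).map out)
  refine ⟨C.extend g, ?_, ?_, ?_⟩
  · rw [C.extend_size]
    omega
  · rw [C.extend_wires]
    refine add_le_add h2 ?_
    rw [← card_univ, ← smul_eq_mul]
    refine sum_le_card_nsmul _ _ _ fun k _ => ?_
    simp only [g]
    split_ifs <;> simpa [Gate.inputs] using hS2 k
  · rintro p (hp | ⟨k, rfl⟩)
    · obtain ⟨v, hv⟩ := h3 p hp
      exact ⟨C.extendInl g v, (C.extend_value_inl g v).trans hv⟩
    · refine ⟨Sum.inr k, ?_⟩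
      have hg : (C.extend g).gate (Sum.inr k) = (g k).mapInputs (C.extendInl g) := rfl
      have hmap : (((S k).map out).map (C.extendInl g)).map (C.extend g).value = S k := by
        rw [Multiset.map_map, Multiset.map_map]
        refine (Multiset.map_congr rfl fun p hp => ?_).trans (Multiset.map_id _)
        exact (C.extend_value_inl g _).trans (hout p (hS1 k p hp))
      by_cases hsum : q k = (S k).sum
      · simp only [g, if_pos hsum, Gate.mapInputs] at hg
        rw [(C.extend g).value_of_add hg, hsum]
        exact congrArg Multiset.sum hmap
      · simp only [g, if_neg hsum, Gate.mapInputs] at hg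
        rw [(C.extend g).value_of_mul hg, (hS3 k).resolve_left hsum]
        exact congrArg Multiset.prod hmap

end CircuitConstruction

/-! ### The exponential sum for the Nisan–Wigderson polynomials -/

section Verifier

variable {n : ℕ} {K : Type*} [Field K]

/-- The product that is `1` on the `l`-th row of a `0/1` matrix with a single `1` in column `a`,
and `0` on other `0/1` rows. -/
def rowSel {R : Type*} [CommRing R] (β : ℕ → Fin n → R) (l : ℕ) (a : Fin n) : R :=
  β l a * ∏ a' ∈ univ.erase a, (1 + -1 * β l a')

/-- Indicator of the event that the first `l` terms of the polynomial with coefficients selected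
by `β` add up to `v` at the `i`-th point. -/
def partialEval (e : Fin n ≃ K) [DecidableEq K] {R : Type*} [CommRing R] (β : ℕ → Fin n → R) :
    ℕ → Fin n → Fin n → R
  | 0, _, v => if e v = 0 then 1 else 0
  | l + 1, i, v => ∑ a, partialEval e β l i (e.symm (e v - e a * e i ^ l)) * rowSel β l a

/-- The summand of the exponential sum for `NW`. -/
def nwSummand (e : Fin n ≃ K) [DecidableEq K] {R : Type*} [CommRing R] (β : ℕ → Fin n → R)
    (z : NWVar n → R) : R :=
  (∑ t : Fin n, z (Sum.inr t) *
    ∏ l ∈ (range n).filter (n / (2 * ((t : ℕ) + 1)) ≤ ·), rowSel β l (e.symm 0)) *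
  ∏ i : Fin n, ∑ v, partialEval e β n i v * z (Sum.inl (i, v))

section Map

variable {R S : Type*} [CommRing R] [CommRing S] (φ : R →+* S)

theorem map_rowSel (β : ℕ → Fin n → R) (l : ℕ) (a : Fin n) :
    φ (rowSel β l a) = rowSel (fun l a => φ (β l a)) l a := by
  simp [rowSel, map_prod]

theorem map_partialEval (e : Fin n ≃ K) [DecidableEq K] (β : ℕ → Fin n → R) (l : ℕ)
    (i v : Fin n) :
    φ (partialEval e β l i v) = partialEval e (fun l a => φ (β l a)) l i v := by
  induction l generalizing v with
  | zero => simp only [partialEval]; split_ifs <;> simp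
  | succ l ih => simp only [partialEval, map_sum, map_mul, ih, map_rowSel]

/-- The summand is defined over any commutative ring, so it can be written in formal bits for the
circuit and transported to actual bits for the summation. -/
theorem map_nwSummand (e : Fin n ≃ K) [DecidableEq K] (β : ℕ → Fin n → R) (z : NWVar n → R) :
    φ (nwSummand e β z) = nwSummand e (fun l a => φ (β l a)) fun v => φ (z v) := by
  simp only [nwSummand, map_mul, map_sum, map_prod, map_partialEval, map_rowSel]

end Map

section Boolean

variable {R : Type*} [CommRing R]

theorem rowSel_oneHot (c : ℕ → Fin n) (l : ℕ) (a : Fin n) :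
    rowSel (fun l a => if c l = a then (1 : R) else 0) l a = if c l = a then 1 else 0 := by
  simp only [rowSel]
  split_ifs with h
  · rw [one_mul]
    refine prod_eq_one fun a' ha' => ?_
    rw [if_neg]
    · simp
    · rintro rfl
      exact (mem_erase.1 ha').1 h
  · rw [zero_mul]

theorem partialEval_oneHot (e : Fin n ≃ K) [DecidableEq K] (c : ℕ → Fin n) (l : ℕ)
    (i v : Fin n) :
    partialEval e (fun l a => if c l = a then (1 : R) else 0) l i v =
      if e v = ∑ j ∈ range l, e (c j) * e i ^ j then 1 else 0 := by
  induction l generalizing v with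
  | zero => by_cases h : e v = 0 <;> simp [partialEval, h]
  | succ l ih =>
    rw [partialEval, sum_eq_single (c l)]
    · rw [ih, rowSel_oneHot, if_pos rfl, mul_one, Equiv.apply_symm_apply, sum_range_succ]
      simp only [sub_eq_iff_eq_add]
    · intro a _ ha
      rw [rowSel_oneHot, if_neg ha.symm, mul_zero]
    · simp

/-- Each step of the recursion carries a factor `rowSel`, so one invalid row kills all later stages.
Bit matrices that encode no coefficient vector therefore drop out of the sum. -/
theorem partialEval_eq_zero (e : Fin n ≃ K) [DecidableEq K] (β : ℕ → Fin n → R) {l₀ : ℕ}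
    (h : ∀ a, rowSel β l₀ a = 0) {l : ℕ} (hl : l₀ < l) (i v : Fin n) :
    partialEval e β l i v = 0 := by
  induction l, hl using Nat.le_induction generalizing v with
  | base => simp [partialEval, h]
  | succ l _ ih => simp [partialEval, ih]

theorem rowSel_eq_zero {β : ℕ → Fin n → R} {l : ℕ} (b : Fin n → Bool)
    (hβ : ∀ a, β l a = if b a then 1 else 0) (h : ¬ ∃ c, ∀ a, b a = decide (c = a)) (a : Fin n) :
    rowSel β l a = 0 := by
  unfold rowSel
  by_cases ha : b a
  · have : ∃ a', a' ≠ a ∧ b a' := by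
      by_contra! hcon
      refine h ⟨a, fun a' => ?_⟩
      by_cases haa : a = a'
      · simp [← haa, ha]
      · simpa [haa] using hcon a' (Ne.symm haa)
    obtain ⟨a', hne, hb⟩ := this
    rw [prod_eq_zero (mem_erase.2 ⟨hne, mem_univ a'⟩) (by rw [hβ, if_pos hb]; ring), mul_zero]
  · rw [hβ, if_neg ha, zero_mul]

end Boolean

/-- The `0/1` matrix of `b`, with rows `l ≥ n` set to zero. -/
def bitMatrix {R : Type*} [Zero R] (b : Fin (n * n) → R) (l : ℕ) (a : Fin n) : R :=
  if h : l < n then b (finProdFinEquiv (⟨l, h⟩, a)) else 0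

theorem rowSel_congr {R : Type*} [CommRing R] {β γ : ℕ → Fin n → R} {l : ℕ}
    (h : ∀ a, β l a = γ l a) (a : Fin n) : rowSel β l a = rowSel γ l a := by
  simp [rowSel, h]

theorem partialEval_congr {R : Type*} [CommRing R] (e : Fin n ≃ K) [DecidableEq K]
    {β γ : ℕ → Fin n → R} {m : ℕ} (h : ∀ l < m, ∀ a, β l a = γ l a) (i v : Fin n) :
    partialEval e β m i v = partialEval e γ m i v := by
  induction m generalizing v with
  | zero => rfl
  | succ m ih =>
    simp only [partialEval]
    refine sum_congr rfl fun a _ => ?_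
    rw [ih (fun l hl => h l (by omega)), rowSel_congr (h m (by omega))]

theorem nwSummand_congr {R : Type*} [CommRing R] (e : Fin n ≃ K) [DecidableEq K]
    {β γ : ℕ → Fin n → R} (h : ∀ l < n, ∀ a, β l a = γ l a) (z : NWVar n → R) :
    nwSummand e β z = nwSummand e γ z := by
  unfold nwSummand
  congr 1
  · refine sum_congr rfl fun t _ => ?_
    congr 1
    refine prod_congr rfl fun l hl => rowSel_congr (h l (mem_range.1 (mem_filter.1 hl).1)) _
  · refine prod_congr rfl fun i _ => sum_congr rfl fun v _ => ?_
    rw [partialEval_congr e h]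

/-- Polynomials are reindexed by vectors of `n` coefficients. The indicator product requires the
coefficients from `r` on to vanish, so the index set no longer depends on `t`. -/
theorem sum_degreeLT_eq [Fintype K] {R : Type*} [CommRing R] (e : Fin n ≃ K) [DecidableEq K]
    {r : ℕ} (hr : r ≤ n) (x : Fin n → Fin n → R) :
    ∑ f : Polynomial.degreeLT K r, ∏ i : Fin n, x i (e.symm ((f : Polynomial K).eval (e i))) =
      ∑ c : Fin n → Fin n,
        (∏ l : Fin n, if r ≤ (l : ℕ) then (if c l = e.symm 0 then (1 : R) else 0) else 1) *
          ∏ i : Fin n, x i (e.symm (∑ l : Fin n, e (c l) * e i ^ (l : ℕ))) := by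
  refine Fintype.sum_of_injective
    (fun (f : Polynomial.degreeLT K r) (l : Fin n) => e.symm ((f : Polynomial K).coeff l)) ?_ _ _
    ?_ ?_
  · intro f g hfg
    refine Subtype.ext (Polynomial.ext fun l => ?_)
    by_cases hl : l < n
    · exact e.symm.injective (congrFun hfg ⟨l, hl⟩)
    · have hz : ∀ p : Polynomial.degreeLT K r, (p : Polynomial K).coeff l = 0 := fun p =>
        Polynomial.coeff_eq_zero_of_degree_lt ((Polynomial.mem_degreeLT.1 p.2).trans_le
          (by exact_mod_cast hr.trans (not_lt.1 hl)))
      rw [hz, hz]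
  · intro c hc
    have : ∃ l : Fin n, r ≤ (l : ℕ) ∧ c l ≠ e.symm 0 := by
      by_contra! hall
      refine hc ⟨⟨∑ l : Fin n, Polynomial.monomial (l : ℕ) (e (c l)), ?_⟩, ?_⟩
      · refine Submodule.sum_mem _ fun l _ => ?_
        rw [Polynomial.mem_degreeLT]
        by_cases hl : r ≤ (l : ℕ)
        · rw [hall l hl]
          simp
        · exact (Polynomial.degree_monomial_le _ _).trans_lt (by exact_mod_cast not_le.1 hl)
      · funext l
        simp only [Polynomial.finsetSum_coeff, Polynomial.coeff_monomial]
        rw [sum_eq_single l]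
        · simp
        · intro b _ hb
          rw [if_neg fun h => hb (Fin.ext h)]
        · simp
    obtain ⟨l, hl, hcl⟩ := this
    rw [prod_eq_zero (mem_univ l) (by rw [if_pos hl, if_neg hcl]), zero_mul]
  · intro f
    have hdeg := Polynomial.mem_degreeLT.1 f.2
    have hone : (∏ l : Fin n, if r ≤ (l : ℕ) then
        (if e.symm ((f : Polynomial K).coeff l) = e.symm 0 then (1 : R) else 0) else 1) = 1 := by
      refine prod_eq_one fun l _ => ?_
      split_ifs with h1 h2
      · rfl
      · exact absurd (congrArg e.symm (Polynomial.coeff_eq_zero_of_degree_lt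
          (hdeg.trans_le (by exact_mod_cast h1)))) h2
      · rfl
    dsimp only
    rw [hone, one_mul]
    refine prod_congr rfl fun i _ => ?_
    congr 2
    rw [Polynomial.eval_eq_sum_range' (n := n), ← Fin.sum_univ_eq_sum_range
      (fun l => (f : Polynomial K).coeff l * e i ^ l)]
    · simp
    · by_cases hf : (f : Polynomial K) = 0
      · rw [hf, Polynomial.natDegree_zero]
        exact i.pos
      · exact (Polynomial.natDegree_lt_iff_degree_lt hf).2
          (hdeg.trans_le (by exact_mod_cast hr))

theorem sum_nwSummand [Fintype K] (F : Type*) [Field F] (e : Fin n ≃ K) [DecidableEq K]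
    (hn : 0 < n) :
    ∑ b : Fin (n * n) → Bool, nwSummand e
      (bitMatrix fun j => if b j then (1 : MvPolynomial (NWVar n) F) else 0) MvPolynomial.X =
      NW F e := by
  have hone : ∀ c : Fin n → Fin n, nwSummand e (bitMatrix fun j : Fin (n * n) =>
      if (decide (c (finProdFinEquiv.symm j).1 = (finProdFinEquiv.symm j).2) : Bool) then
        (1 : MvPolynomial (NWVar n) F) else 0) MvPolynomial.X =
      ∑ t : Fin n, MvPolynomial.X (Sum.inr t) *
        ((∏ l : Fin n, if n / (2 * ((t : ℕ) + 1)) ≤ (l : ℕ) then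
          (if c l = e.symm 0 then (1 : MvPolynomial (NWVar n) F) else 0) else 1) *
          ∏ i : Fin n, MvPolynomial.X
            (Sum.inl (i, e.symm (∑ l : Fin n, e (c l) * e i ^ (l : ℕ))))) := by
    intro c
    set c' : ℕ → Fin n := fun l => if h : l < n then c ⟨l, h⟩ else ⟨0, hn⟩ with hc'
    have hcc : ∀ l : Fin n, c' l = c l := fun l => by simp [hc']
    rw [nwSummand_congr e (γ := fun l a => if c' l = a then 1 else 0)]
    · simp only [nwSummand, rowSel_oneHot, partialEval_oneHot]
      rw [sum_mul]
      refine sum_congr rfl fun t _ => ?_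
      rw [mul_assoc]
      congr 2
      · rw [prod_filter, ← Fin.prod_univ_eq_prod_range (fun l => if n / (2 * ((t : ℕ) + 1)) ≤ l then
          (if c' l = e.symm 0 then (1 : MvPolynomial (NWVar n) F) else 0) else 1)]
        simp only [hcc]
      · refine prod_congr rfl fun i _ => ?_
        rw [sum_eq_single (e.symm (∑ l : Fin n, e (c l) * e i ^ (l : ℕ)))]
        · rw [if_pos, one_mul]
          rw [Equiv.apply_symm_apply, ← Fin.sum_univ_eq_sum_range (fun l => e (c' l) * e i ^ l)]
          simp only [hcc]
        · intro v _ hv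
          rw [if_neg, zero_mul]
          intro h
          refine hv ?_
          rw [Equiv.eq_symm_apply, h,
            ← Fin.sum_univ_eq_sum_range (fun l => e (c' l) * e i ^ l)]
          simp only [hcc]
        · simp
    · intro l hl a
      simp [bitMatrix, hl, hc']
  -- One-hot matrices correspond injectively to coefficient vectors `c`; all other matrices
  -- contribute zero.
  rw [← Fintype.sum_of_injective
    (fun (c : Fin n → Fin n) (j : Fin (n * n)) =>
      (decide (c (finProdFinEquiv.symm j).1 = (finProdFinEquiv.symm j).2) : Bool))
    ?_ _ _ ?_ (fun c => (hone c).symm)]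
  · rw [sum_comm]
    unfold NW
    refine sum_congr rfl fun t _ => ?_
    rw [← mul_sum]
    congr 1
    rw [NWt]
    exact (sum_degreeLT_eq e (Nat.div_le_self _ _)
      fun i j => (MvPolynomial.X (Sum.inl (i, j)) : MvPolynomial (NWVar n) F)).symm
  · intro c c' h
    funext l
    have := congrFun h (finProdFinEquiv (l, c l))
    simp only [Equiv.symm_apply_apply, decide_true] at this
    exact (of_decide_eq_true this.symm).symm
  · intro b hb
    have hrow : ∃ l : Fin n, ¬ ∃ c, ∀ a, b (finProdFinEquiv (l, a)) = decide (c = a) := by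
      by_contra! hall
      choose c hc using hall
      refine hb ⟨c, funext fun j => ?_⟩
      obtain ⟨⟨l, a⟩, rfl⟩ := finProdFinEquiv.surjective j
      simp only [Equiv.symm_apply_apply]
      exact (hc l a).symm
    obtain ⟨l, hl⟩ := hrow
    -- A single vanishing block suffices; block `0` exists because `n > 0`.
    rw [nwSummand, prod_eq_zero (mem_univ ⟨0, hn⟩), mul_zero]
    refine sum_eq_zero fun v _ => ?_
    rw [partialEval_eq_zero e _ (rowSel_eq_zero (fun a => b (finProdFinEquiv (l, a)))
      (fun a => ?_) hl) l.2, zero_mul]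
    simp [bitMatrix]

end Verifier

/-! ### Degree and circuit size of the summand; membership in VNP -/

section NWInVNP

variable {n : ℕ} {K : Type*} [Field K] (F : Type*) [Field F]

/-- The auxiliary variables as a matrix. -/
noncomputable def bitVar (n : ℕ) : ℕ → Fin n → MvPolynomial (NWVar n ⊕ Fin (n * n)) F :=
  bitMatrix fun j => MvPolynomial.X (Sum.inr j)

/-- The polynomial whose sum over the `0/1` values of the auxiliary variables is `NW`. -/
noncomputable def nwVerifier (e : Fin n ≃ K) [DecidableEq K] :
    MvPolynomial (NWVar n ⊕ Fin (n * n)) F :=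
  nwSummand e (bitVar F n) fun v => MvPolynomial.X (Sum.inl v)

theorem aeval_nwVerifier (e : Fin n ≃ K) [DecidableEq K] (b : Fin (n * n) → Bool) :
    MvPolynomial.aeval (Sum.elim MvPolynomial.X fun j =>
      if b j then (1 : MvPolynomial (NWVar n) F) else 0) (nwVerifier F e) =
      nwSummand e (bitMatrix fun j => if b j then (1 : MvPolynomial (NWVar n) F) else 0)
        MvPolynomial.X := by
  have h := map_nwSummand (MvPolynomial.aeval (Sum.elim MvPolynomial.X fun j =>
    if b j then (1 : MvPolynomial (NWVar n) F) else 0)).toRingHom e (bitVar F n)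
    fun v => MvPolynomial.X (Sum.inl v)
  refine h.trans ?_
  congr 1
  · funext l a
    simp only [bitVar, bitMatrix, AlgHom.toRingHom_eq_coe, RingHom.coe_coe]
    split_ifs <;> simp_all
  · funext v
    simp

section Degree

theorem totalDegree_bitVar_le (l : ℕ) (a : Fin n) : (bitVar F n l a).totalDegree ≤ 1 := by
  unfold bitVar bitMatrix
  split_ifs <;> simp

theorem totalDegree_rowSel_le (l : ℕ) (a : Fin n) :
    (rowSel (bitVar F n) l a).totalDegree ≤ n := by
  unfold rowSel
  refine (MvPolynomial.totalDegree_mul _ _).trans ?_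
  have h1 : (∏ a' ∈ univ.erase a, (1 + -1 * bitVar F n l a')).totalDegree ≤ n - 1 := by
    refine (MvPolynomial.totalDegree_finsetProd _ _).trans ?_
    refine (sum_le_card_nsmul _ _ 1 fun a' _ => ?_).trans (by simp)
    refine (MvPolynomial.totalDegree_add _ _).trans (max_le (by simp) ?_)
    rw [neg_one_mul, MvPolynomial.totalDegree_neg]
    exact totalDegree_bitVar_le F l a'
  have h2 := totalDegree_bitVar_le F l a
  have := a.pos
  omega

theorem totalDegree_partialEval_le (e : Fin n ≃ K) [DecidableEq K] (l : ℕ) (i v : Fin n) :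
    (partialEval e (bitVar F n) l i v).totalDegree ≤ l * n := by
  induction l generalizing v with
  | zero => simp only [partialEval]; split_ifs <;> simp
  | succ l ih =>
    refine MvPolynomial.totalDegree_finsetSum_le fun a _ => ?_
    refine (MvPolynomial.totalDegree_mul _ _).trans ?_
    rw [add_mul, one_mul]
    exact add_le_add (ih _) (totalDegree_rowSel_le F l a)

theorem totalDegree_nwVerifier_le (e : Fin n ≃ K) [DecidableEq K] :
    (nwVerifier F e).totalDegree ≤ (1 + n * n) + n * (n * n + 1) := by
  refine (MvPolynomial.totalDegree_mul _ _).trans (add_le_add ?_ ?_)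
  · refine MvPolynomial.totalDegree_finsetSum_le fun t _ => ?_
    refine (MvPolynomial.totalDegree_mul _ _).trans (add_le_add (by simp) ?_)
    refine (MvPolynomial.totalDegree_finsetProd _ _).trans ?_
    refine (sum_le_card_nsmul _ _ n fun l _ => totalDegree_rowSel_le F l _).trans ?_
    exact Nat.mul_le_mul ((card_filter_le _ _).trans (by simp)) le_rfl
  · refine (MvPolynomial.totalDegree_finsetProd _ _).trans ?_
    refine (sum_le_card_nsmul _ _ (n * n + 1) fun i _ => ?_).trans (by simp)
    refine MvPolynomial.totalDegree_finsetSum_le fun v _ => ?_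
    refine (MvPolynomial.totalDegree_mul _ _).trans (add_le_add ?_ (by simp))
    exact totalDegree_partialEval_le F e n i v

end Degree

section Circuit

theorem hasCircuit_leaves_nw (n : ℕ) :
    HasCircuit (Set.range (MvPolynomial.X : _ → MvPolynomial (NWVar n ⊕ Fin (n * n)) F) ∪
      {0, 1, -1}) (2 * (n * n) + n + 3) 0 := by
  have h := hasCircuit_leaves (σ := NWVar n ⊕ Fin (n * n)) (ι := (NWVar n ⊕ Fin (n * n)) ⊕ Fin 3)
    (Sum.elim Sum.inr fun k => Sum.inl (![(0 : F), 1, -1] k))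
  have hcard : Fintype.card ((NWVar n ⊕ Fin (n * n)) ⊕ Fin 3) = 2 * (n * n) + n + 3 := by
    simp
    ring
  rw [hcard] at h
  refine h.mono ?_
  rintro p (⟨x, rfl⟩ | rfl | rfl | rfl)
  · exact ⟨Sum.inl x, rfl⟩
  · exact ⟨Sum.inr 0, by simp⟩
  · exact ⟨Sum.inr 1, by simp⟩
  · exact ⟨Sum.inr 2, by simp⟩

theorem hasCircuit_rowSel (n : ℕ) :
    HasCircuit (Set.range (MvPolynomial.X : _ → MvPolynomial (NWVar n ⊕ Fin (n * n)) F) ∪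
      {0, 1, -1} ∪ Set.range fun x : Fin n × Fin n => rowSel (bitVar F n) x.1 x.2)
      (5 * (n * n) + n + 3) (4 * (n * n) + n * n * n) := by
  have h0 := hasCircuit_leaves_nw F n
  have hbit : ∀ x : Fin n × Fin n, bitVar F n x.1 x.2 ∈
      Set.range (MvPolynomial.X : _ → MvPolynomial (NWVar n ⊕ Fin (n * n)) F) := by
    intro x
    simp [bitVar, bitMatrix]
  have h1 := h0.layer (fun x : Fin n × Fin n => -1 * bitVar F n x.1 x.2) 2 fun x =>
    ⟨{-1, bitVar F n x.1 x.2}, by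
      intro p hp
      simp only [Multiset.insert_eq_cons, Multiset.mem_cons, Multiset.mem_singleton] at hp
      rcases hp with rfl | rfl
      · right; simp
      · exact Or.inl (hbit x), by simp, Or.inr (by simp)⟩
  have h2 := h1.layer (fun x : Fin n × Fin n => 1 + -1 * bitVar F n x.1 x.2) 2 fun x =>
    ⟨{1, -1 * bitVar F n x.1 x.2}, by
      intro p hp
      simp only [Multiset.insert_eq_cons, Multiset.mem_cons, Multiset.mem_singleton] at hp
      rcases hp with rfl | rfl
      · left; right; simp
      · exact Or.inr ⟨x, rfl⟩, by simp, Or.inl (by simp)⟩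
  have h3 := h2.layer (fun x : Fin n × Fin n => rowSel (bitVar F n) x.1 x.2) n fun x =>
    ⟨bitVar F n x.1 x.2 ::ₘ ((univ.erase x.2).val.map fun a => 1 + -1 * bitVar F n x.1 a), by
      intro p hp
      rcases Multiset.mem_cons.1 hp with rfl | hp
      · exact Or.inl (Or.inl (Or.inl (hbit x)))
      · obtain ⟨a, -, rfl⟩ := Multiset.mem_map.1 hp
        exact Or.inr ⟨(x.1, a), rfl⟩, by
      have := x.1.pos
      rw [Multiset.card_cons, Multiset.card_map, card_val, card_erase_of_mem (mem_univ _),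
        card_univ, Fintype.card_fin]
      omega, Or.inr (by rw [Multiset.prod_cons]; rfl)⟩
  have hs : 2 * (n * n) + n + 3 + Fintype.card (Fin n × Fin n) + Fintype.card (Fin n × Fin n) +
      Fintype.card (Fin n × Fin n) = 5 * (n * n) + n + 3 := by
    simp only [Fintype.card_prod, Fintype.card_fin]; ring
  have hw : 0 + Fintype.card (Fin n × Fin n) * 2 + Fintype.card (Fin n × Fin n) * 2 +
      Fintype.card (Fin n × Fin n) * n = 4 * (n * n) + n * n * n := by
    simp only [Fintype.card_prod, Fintype.card_fin]; ring
  rw [hs, hw] at h3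
  refine h3.mono ?_
  rintro p (hp | hp)
  · exact Or.inl (Or.inl (Or.inl hp))
  · exact Or.inr hp

theorem hasCircuit_partialEval (e : Fin n ≃ K) [DecidableEq K] {l : ℕ} (hl : l ≤ n) :
    HasCircuit (Set.range (MvPolynomial.X : _ → MvPolynomial (NWVar n ⊕ Fin (n * n)) F) ∪
      {0, 1, -1} ∪ (Set.range fun x : Fin n × Fin n => rowSel (bitVar F n) x.1 x.2) ∪
      Set.range fun x : Fin n × Fin n => partialEval e (bitVar F n) l x.1 x.2)
      (5 * (n * n) + n + 3 + l * (n * n * n + n * n))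
      (4 * (n * n) + n * n * n + l * (3 * (n * n * n))) := by
  induction l with
  | zero =>
    rw [zero_mul, zero_mul, add_zero, add_zero]
    refine (hasCircuit_rowSel F n).mono (Set.union_subset subset_rfl ?_)
    rintro _ ⟨x, rfl⟩
    left; right
    simp only [partialEval]
    split_ifs <;> simp
  | succ l ih =>
    have h1 := (ih (by omega)).layer (fun x : (Fin n × Fin n) × Fin n =>
      partialEval e (bitVar F n) l x.1.1 (e.symm (e x.1.2 - e x.2 * e x.1.1 ^ l)) *
        rowSel (bitVar F n) l x.2) 2 fun x =>
      ⟨{partialEval e (bitVar F n) l x.1.1 (e.symm (e x.1.2 - e x.2 * e x.1.1 ^ l)),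
        rowSel (bitVar F n) l x.2}, by
        intro p hp
        simp only [Multiset.insert_eq_cons, Multiset.mem_cons, Multiset.mem_singleton] at hp
        rcases hp with rfl | rfl
        -- The index `e.symm (…)` is a fixed element of `Fin n`, so the arithmetic of `K` only
        -- decides which node is wired in and needs no gates over `F`.
        · exact Or.inr ⟨(x.1.1, e.symm (e x.1.2 - e x.2 * e x.1.1 ^ l)), rfl⟩
        · exact Or.inl (Or.inr ⟨(⟨l, hl⟩, x.2), rfl⟩), by simp, Or.inr (by simp)⟩
    have h2 := h1.layer (fun x : Fin n × Fin n => partialEval e (bitVar F n) (l + 1) x.1 x.2) n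
      fun x => ⟨(univ : Finset (Fin n)).val.map fun a =>
        partialEval e (bitVar F n) l x.1 (e.symm (e x.2 - e a * e x.1 ^ l)) *
          rowSel (bitVar F n) l a, by
        intro p hp
        obtain ⟨a, -, rfl⟩ := Multiset.mem_map.1 hp
        exact Or.inr ⟨(x, a), rfl⟩, by simp, Or.inl rfl⟩
    have hs : 5 * (n * n) + n + 3 + l * (n * n * n + n * n) +
        Fintype.card ((Fin n × Fin n) × Fin n) + Fintype.card (Fin n × Fin n) =
        5 * (n * n) + n + 3 + (l + 1) * (n * n * n + n * n) := by
      simp only [Fintype.card_prod, Fintype.card_fin]; ring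
    have hw : 4 * (n * n) + n * n * n + l * (3 * (n * n * n)) +
        Fintype.card ((Fin n × Fin n) × Fin n) * 2 + Fintype.card (Fin n × Fin n) * n =
        4 * (n * n) + n * n * n + (l + 1) * (3 * (n * n * n)) := by
      simp only [Fintype.card_prod, Fintype.card_fin]; ring
    rw [hs, hw] at h2
    refine h2.mono ?_
    rintro p (hp | hp)
    · exact Or.inl (Or.inl (Or.inl hp))
    · exact Or.inr hp

theorem exists_circuit_nwVerifier (e : Fin n ≃ K) [DecidableEq K] :
    ∃ C : ArithCircuit F (NWVar n ⊕ Fin (n * n)), C.poly = nwVerifier F e ∧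
      C.size ≤ 100 * (n + 1) ^ 6 ∧ C.wires ≤ 100 * (n + 1) ^ 6 := by
  have h1 := (hasCircuit_partialEval F e le_rfl).layer (fun x : Fin n × Fin n =>
    partialEval e (bitVar F n) n x.1 x.2 * MvPolynomial.X (Sum.inl (Sum.inl (x.1, x.2)))) 2 fun x =>
    ⟨{partialEval e (bitVar F n) n x.1 x.2, MvPolynomial.X (Sum.inl (Sum.inl (x.1, x.2)))}, by
      intro p hp
      simp only [Multiset.insert_eq_cons, Multiset.mem_cons, Multiset.mem_singleton] at hp
      rcases hp with rfl | rfl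
      · exact Or.inr ⟨x, rfl⟩
      · exact Or.inl (Or.inl (Or.inl ⟨_, rfl⟩)), by simp, Or.inr (by simp)⟩
  have h2 := h1.layer (fun i : Fin n => ∑ v, partialEval e (bitVar F n) n i v *
      MvPolynomial.X (Sum.inl (Sum.inl (i, v)))) n fun i =>
    ⟨(univ : Finset (Fin n)).val.map fun v => partialEval e (bitVar F n) n i v *
      MvPolynomial.X (Sum.inl (Sum.inl (i, v))), by
      intro p hp
      obtain ⟨v, -, rfl⟩ := Multiset.mem_map.1 hp
      exact Or.inr ⟨(i, v), rfl⟩, by simp, Or.inl rfl⟩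
  have h3 := h2.layer (fun t : Fin n => MvPolynomial.X (Sum.inl (Sum.inr t)) *
      ∏ l ∈ (range n).filter (n / (2 * ((t : ℕ) + 1)) ≤ ·),
        rowSel (bitVar F n) l (e.symm 0)) (n + 1) fun t =>
    ⟨MvPolynomial.X (Sum.inl (Sum.inr t)) ::ₘ
      ((range n).filter (n / (2 * ((t : ℕ) + 1)) ≤ ·)).val.map
        fun l => rowSel (bitVar F n) l (e.symm 0), by
      intro p hp
      rcases Multiset.mem_cons.1 hp with rfl | hp
      · exact Or.inl (Or.inl (Or.inl (Or.inl (Or.inl ⟨_, rfl⟩))))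
      · obtain ⟨l, hl, rfl⟩ := Multiset.mem_map.1 hp
        exact Or.inl (Or.inl (Or.inl (Or.inr
          ⟨(⟨l, mem_range.1 (mem_filter.1 hl).1⟩, e.symm 0), rfl⟩))), by
      rw [Multiset.card_cons, Multiset.card_map, card_val]
      exact Nat.succ_le_succ ((card_filter_le _ _).trans (by simp)),
      Or.inr (by rw [Multiset.prod_cons]; rfl)⟩
  have h4 := h3.layer (fun _ : Unit => ∑ t : Fin n, MvPolynomial.X (Sum.inl (Sum.inr t)) *
      ∏ l ∈ (range n).filter (n / (2 * ((t : ℕ) + 1)) ≤ ·),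
        rowSel (bitVar F n) l (e.symm 0)) n fun _ =>
    ⟨(univ : Finset (Fin n)).val.map fun t : Fin n => MvPolynomial.X (Sum.inl (Sum.inr t)) *
      ∏ l ∈ (range n).filter (n / (2 * ((t : ℕ) + 1)) ≤ ·), rowSel (bitVar F n) l (e.symm 0), by
      intro p hp
      obtain ⟨t, -, rfl⟩ := Multiset.mem_map.1 hp
      exact Or.inr ⟨t, rfl⟩, by simp, Or.inl rfl⟩
  have h5 := h4.layer (fun _ : Unit => nwVerifier F e) (n + 1) fun _ =>
    ⟨(∑ t : Fin n, MvPolynomial.X (Sum.inl (Sum.inr t)) *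
      ∏ l ∈ (range n).filter (n / (2 * ((t : ℕ) + 1)) ≤ ·), rowSel (bitVar F n) l (e.symm 0)) ::ₘ
      (univ : Finset (Fin n)).val.map fun i => ∑ v, partialEval e (bitVar F n) n i v *
        MvPolynomial.X (Sum.inl (Sum.inl (i, v))), by
      intro p hp
      rcases Multiset.mem_cons.1 hp with rfl | hp
      · exact Or.inr ⟨(), rfl⟩
      · obtain ⟨i, -, rfl⟩ := Multiset.mem_map.1 hp
        exact Or.inl (Or.inl (Or.inr ⟨i, rfl⟩)), by simp,
      Or.inr (by rw [Multiset.prod_cons]; rfl)⟩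
  obtain ⟨C, hs, hw, hC⟩ := h5.exists_poly_eq (Or.inr ⟨(), rfl⟩)
  simp only [Fintype.card_prod, Fintype.card_fin, Fintype.card_unit] at hs hw
  have hexp : (n + 1) ^ 6 = n ^ 6 + 6 * n ^ 5 + 15 * n ^ 4 + 20 * n ^ 3 + 15 * n ^ 2 + 6 * n + 1 := by
    ring
  refine ⟨C, hC, hs.trans ?_, hw.trans ?_⟩
  · rw [hexp]
    ring_nf
    omega
  · rw [hexp]
    ring_nf
    omega

end Circuit

end NWInVNP

theorem nw_inVNP (F : Type*) [Field F] (K : primePowers → Type) [∀ n, Field (K n)]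
    [∀ n, Fintype (K n)] (e : ∀ n : primePowers, Fin (n : ℕ) ≃ K n) :
    InVNP F (fun n : primePowers => NW F (e n)) := by
  classical
  refine ⟨100 * (Polynomial.X + 1) ^ 6, fun n => ?_⟩
  have heval : (100 * (Polynomial.X + 1) ^ 6 : Polynomial ℕ).eval (n : ℕ) =
      100 * ((n : ℕ) + 1) ^ 6 := by
    rw [Polynomial.eval_mul, Polynomial.eval_pow, Polynomial.eval_add, Polynomial.eval_X,
      Polynomial.eval_one, Polynomial.eval_ofNat]
  rw [heval]
  have hexp : ((n : ℕ) + 1) ^ 6 = (n : ℕ) ^ 6 + 6 * (n : ℕ) ^ 5 + 15 * (n : ℕ) ^ 4 +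
      20 * (n : ℕ) ^ 3 + 15 * (n : ℕ) ^ 2 + 6 * (n : ℕ) + 1 := by ring
  obtain ⟨C, hC, hs, hw⟩ := exists_circuit_nwVerifier F (e n)
  refine ⟨?_, ?_, (n : ℕ) * n, C, ?_, hs, hw, ?_, ?_⟩
  · simp only [Fintype.card_sum, Fintype.card_prod, Fintype.card_fin]
    rw [hexp]
    ring_nf
    omega
  · refine (NW_isHomogeneous F (e n)).totalDegree_le.trans ?_
    rw [hexp]
    omega
  · rw [hexp]
    ring_nf
    omega
  · rw [hC]
    refine (totalDegree_nwVerifier_le F (e n)).trans ?_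
    rw [hexp]
    ring_nf
    omega
  · rw [hC]
    simp only [aeval_nwVerifier]
    exact (sum_nwSummand F (e n) (IsPrimePow.pos n.2)).symm

/-! ### Assembling the lower bound -/

theorem MvPolynomial.isHomogeneous_prod_map_fst {F σ : Type*} [CommSemiring F]
    (P : Multiset (MvPolynomial σ F × ℕ)) (h : ∀ q ∈ P, q.1.IsHomogeneous q.2) :
    ((P.map Prod.fst).prod).IsHomogeneous (P.map Prod.snd).sum := by
  induction P using Multiset.induction_on with
  | empty => simpa using MvPolynomial.isHomogeneous_one σ F
  | cons a P ih =>
    simp only [Multiset.map_cons, Multiset.prod_cons, Multiset.sum_cons]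
    exact (h a (Multiset.mem_cons_self a P)).mul (ih fun q hq => h q (Multiset.mem_cons_of_mem hq))

theorem IsUniformSum.isHomogeneous {F σ : Type*} [CommSemiring F] {D : Multiset ℕ} {s : ℕ}
    {p : MvPolynomial σ F} (h : IsUniformSum D s p) : p.IsHomogeneous D.sum := by
  obtain ⟨ι, _, c, P, -, hD, hP, rfl⟩ := h.exists_terms
  refine MvPolynomial.IsHomogeneous.sum _ _ _ fun i _ => ?_
  rw [← hD i, ← zero_add (Multiset.sum _)]
  exact (MvPolynomial.isHomogeneous_C _ _).mul
    (MvPolynomial.isHomogeneous_prod_map_fst _ fun q hq => (hP i q hq).1)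

theorem exp_sqrt_le_of_isUniformSum {n : ℕ} {K : Type*} [Field K] [Fintype K] {F : Type*} [Field F]
    (e : Fin n ≃ K) {D : Multiset ℕ} {s : ℕ} (h : IsUniformSum D s (NW F e))
    (hlog : 20000 ≤ Real.log n) : Real.exp (Real.sqrt n) ≤ s := by
  have hn : 20000 ≤ n := by
    have := hlog.trans (Real.log_le_self (Nat.cast_nonneg n))
    exact_mod_cast this
  have hsum : D.sum = n + 1 :=
    h.isHomogeneous.inj_right (NW_isHomogeneous F e) (NW_ne_zero F e (by omega))
  have hsplit : (D.filter (· ≤ Nat.sqrt n)).sum + (D.filter (¬ · ≤ Nat.sqrt n)).sum = n + 1 := by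
    rw [← Multiset.sum_add, Multiset.filter_add_not, hsum]
  -- Either the small factors carry a constant fraction of the degree and grouping them pays off, or
  -- they are too few to produce all the monomials.
  by_cases hW : n ≤ 10 * (D.filter (· ≤ Nat.sqrt n)).sum
  · have hT1 : 1 ≤ Nat.sqrt n := by rw [Nat.le_sqrt]; omega
    have hT : 20 * Nat.sqrt n ≤ n := by
      have h1 : 20 ≤ Nat.sqrt n := by rw [Nat.le_sqrt]; omega
      exact (Nat.mul_le_mul_right _ h1).trans (Nat.sqrt_le n)
    have ht : 20 * Nat.sqrt n - 1 + 1 = 20 * Nat.sqrt n := by omega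
    refine exp_sqrt_le_of_shifted_bound hlog hn hsplit hW rfl fun l => ?_
    -- The index `i` stands for `t = i + 1`, so this is `t = 20 * ⌊√n⌋`.
    exact h.nw_shifted_bound e ⟨20 * Nat.sqrt n - 1, by omega⟩ (Nat.sqrt n) l hT1
      (by rw [ht])
  · refine exp_sqrt_le_of_card_bound (W := (D.filter (· ≤ Nat.sqrt n)).sum) (by linarith) (by omega) (by omega)
      ((Multiset.mul_card_filter_le D (Nat.sqrt n)).trans hsum.le) ?_
    have hcard : Fintype.card (NWVar n) = n ^ 2 + n := by
      simp [pow_two]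
    rw [← hcard]
    exact (card_support_NW_ge F e (by omega)).trans (h.card_support_le (Nat.sqrt n))

theorem exp_rpow_le_six {n : ℕ} (hn : 0 < n) (hlog : Real.log n ≤ 20000) :
    Real.exp ((n : ℝ) ^ (1 / 100000 : ℝ)) ≤ 6 := by
  have hn' : (0 : ℝ) < n := by exact_mod_cast hn
  have h1 : (n : ℝ) ^ (1 / 100000 : ℝ) ≤ 3 / 2 := by
    rw [Real.rpow_def_of_pos hn']
    refine (Real.exp_le_exp.2 (show _ ≤ (1 / 5 : ℝ) by linarith)).trans ?_
    have h2 : Real.exp (1 / 5) ^ 5 = Real.exp 1 := by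
      rw [← Real.exp_nat_mul]; norm_num
    refine le_of_pow_le_pow_left₀ (n := 5) (by norm_num) (by norm_num) ?_
    rw [h2]
    have := Real.exp_one_lt_d9
    norm_num
    linarith
  refine (Real.exp_le_exp.2 h1).trans ?_
  refine le_of_pow_le_pow_left₀ (n := 2) (by norm_num) (by norm_num) ?_
  have h3 : Real.exp (3 / 2) ^ 2 = Real.exp 1 ^ 3 := by
    rw [← Real.exp_nat_mul, ← Real.exp_nat_mul]; norm_num
  rw [h3]
  have h4 : Real.exp 1 ≤ 2.72 := by
    have := Real.exp_one_lt_d9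
    linarith
  calc Real.exp 1 ^ 3 ≤ 2.72 ^ 3 := pow_le_pow_left₀ (Real.exp_pos 1).le h4 3
    _ ≤ 6 ^ 2 := by norm_num

end LowerBoundAndVNP

theorem theorem4 :
    ∃ ε : ℝ, 0 < ε ∧
      ∀ (F : Type*) [Field F]
        (K : primePowers → Type) [∀ n, Field (K n)] [∀ n, Fintype (K n)]
        (e : ∀ n : primePowers, Fin (n : ℕ) ≃ K n),
        InVNP F (fun n : primePowers => NW F (e n)) ∧
        ∀ n : primePowers,
          (NW F (e n)).IsHomogeneous ((n : ℕ) + 1) ∧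
          (NW F (e n)).totalDegree = (n : ℕ) + 1 ∧
          (NW F (e n)).vars.card = (n : ℕ) ^ 2 + (n : ℕ) ∧
          ∀ C : ArithCircuit F (NWVar (n : ℕ)),
            C.IsHomogeneousSPSPStar → C.poly = NW F (e n) →
              Real.exp (((n : ℕ) : ℝ) ^ ε) ≤ (C.size : ℝ) := by
  -- The exponent is so small that for `log n ≤ 20000` the claimed bound is at most 6, hence at most
  -- the number `n² + n` of variables. For larger `n` the bound `exp(√n)` is far more than needed.
  refine ⟨1 / 100000, by norm_num, fun F _ K _ _ e => ⟨nw_inVNP F K e, fun n => ?_⟩⟩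
  have hn : 2 ≤ (n : ℕ) := IsPrimePow.two_le n.2
  have hhom := NW_isHomogeneous F (e n)
  have hvars : (NW F (e n)).vars.card = (n : ℕ) ^ 2 + (n : ℕ) := by
    rw [vars_NW F (e n) hn, Finset.card_univ]
    simp [pow_two]
  refine ⟨hhom, hhom.totalDegree (NW_ne_zero F (e n) hn), hvars, fun C hC hpoly => ?_⟩
  by_cases hlog : Real.log (n : ℕ) ≤ 20000
  · have hsize := C.card_vars_le_size
    rw [hpoly, hvars] at hsize
    have h6 : 6 ≤ C.size := by nlinarith
    exact (exp_rpow_le_six (by omega) hlog).trans (by exact_mod_cast h6)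
  · obtain ⟨D, hD⟩ := hC.isUniformSum
    rw [hpoly] at hD
    refine le_trans (Real.exp_le_exp.2 ?_) (exp_sqrt_le_of_isUniformSum (e n) hD (not_le.1 hlog).le)
    rw [Real.sqrt_eq_rpow]
    exact Real.rpow_le_rpow_of_exponent_le (by exact_mod_cast (by omega : 1 ≤ (n : ℕ)))
      (by norm_num)
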